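/- **Theorem (Recognition of full binary trees).** *Graphs and rules.* A graph is a finite directed multigraph $G=(V,E,s,t,l,m,p)$ with a partial node labelling $l:V\rightharpoonup\{\square,\triangle\}$, a total edge labelling $m:E\to\{\square\}$ and a partial rootedness function $p:V\rightharpoonup\{0,1\}$ ($1$ = rooted); it is a TLRG if $l$ and $p$ are total. Morphisms preserve sources, targets, edge labels, and node labels and rootedness wherever these are defined. A rule $L\leftarrow K\rightarrow R$ consists of TLRGs $L,R$, a graph $K$ and injective morphisms $K\to L$, $K\to R$. A match in a TLRG $G$ is an injective morphism $g:L\to G$ such that no edge of $G$ outside $g(L)$ is incident to a node of $g(L\setminus K)$. Applying the rule deletes $g(L\setminus K)$, adds $R\setminus K$ disjointly, and gives the image of every node of $K$ whose label (rootedness) is undefined in $K$ the label (rootedness) it has in $R$. $G\Rightarrow H$ means that $H$ is isomorphic to the result of applying one of the rules to $G$; $\Rightarrow^*$ allows any number of steps (zero steps: isomorphism). $H$ is a normal form of $G$ if $G\Rightarrow^*H$ and no rule is applicable to $H$. *The system.* All edges are labelled $\square$; all nodes are unrooted unless called rooted. Let $\mathcal R=\{r_0,\dots,r_4\}$, where the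 interfaces consist of the numbered nodes only, with undefined label and rootedness and without edges: - $r_0$: left, a rooted $\square$ with edges to two $\square$-nodes; right, a single rooted $\square$; empty interface. - $r_1$: left, a node 1 labelled $\square$ with an edge to a rooted $\square$, which has edges to two further $\square$-nodes; right, node 1 as a rooted $\square$ with an edge to a $\square$-node. - $r_2$: as $r_1$, except that node 1 is labelled $\triangle$ on the left. - $r_3$: left, a path $1\to2\to3$ of $\square$-nodes with 1 rooted; right, the path $1\to2\to3$ with 1 labelled $\triangle$, 2 and 3 labelled $\square$, and 2 rooted. - $r_4$: left, a node 1 labelled $\square$ with an edge to a rooted $\square$; right, node 1 as a rooted $\square$ with an edge to a $\square$-node. *Input graphs and full binary trees.* An input graph is a TLRG with exactly one rooted node and all nodes and edges labelled $\square$. $G^{\ominus}$ is $G$ with every node unrooted and everything labelled $\square$. A full binary tree is a non-empty connected graph without undirected cycles (closed undirected walks of positive length that repeat no edge; loops and parallel edges give such cycles) in which every node has at most one incoming edge, at most two outgoing edges, and either $0$ or $2$ children. *Claim.* 1. There is a constant $c$ such that every derivation from an input graph $G$ has length at most $c\,|V_G|$. In particular there is no infinite derivation from $G$, and $G$ has a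 normal form. 2. For every input graph $G$ and every normal form $H$ of $G$: $H$ is isomorphic to the graph consisting of a single rooted $\square$-node and no edges if and only if $G^{\ominus}$ is a full binary tree. 3. On input graphs of bounded degree, rewriting to a normal form takes linear time. Precisely: consider programs on a stored graph with finitely many node registers, edge registers and flags, built with sequencing, conditionals and while-loops, where one step is charged for following an edge to its source or target, testing labels, rootedness, equality, in- or outdegree, $|V|$ or $|E|$ against a constant, copying a register, setting a flag, and creating or deleting an edge or a node (only isolated nodes may be deleted); changing the label or rootedness of a node costs one step plus the current number of rooted nodes; looping over the edges with a given source (or target), or over the rooted nodes with a given label, costs one step plus the size of that set, and over the unrooted nodes with a given label one step plus $|V|$, in addition to the time spent in the loop body. Then there is a single program $B$ such that for every $b$ there are constants $k,C$ for which the following holds for every input graph $G$ all of whose nodes have degree at most $b$: (i) started on any stored copy of any $H$ with $G\Rightarrow^*H$, with any contents of the registers and flags, $B$ halts within $k$ steps and either replaces $H$ by some $H'$ with $H\Rightarrow H'$ and leaves a designated flag up, or, if $H$ is in normal form, leaves a copy of $H$ in the store and takes the flag down; (ii) repeating $B$ while the flag is up, started on any stored copy of $G$ with any contents of the registers and flags,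 halts after at most $C\,|V_G|$ steps with a normal form of $G$ in the store. -/

import Mathlib

/-! ## Graphs with partial node labels and partial rootedness -/

/-- A finite directed multigraph over the label alphabet `(LV, LE)`: the vertex labelling `l` and
the rootedness `p` are partial functions (`none` means undefined; `some true` means rooted and
`some false` means unrooted), the edge labelling `m` is total. -/
structure RGraph (LV LE : Type) where
  V : Type
  E : Type
  finV : Finite V
  finE : Finite E
  s : E → V
  t : E → V
  l : V → Option LV
  m : E → LE
  p : V → Option Bool

namespace RGraph

variable {LV LE : Type}

/-- Totally labelled and totally rooted graphs. -/
def IsTLRG (G : RGraph LV LE) : Prop :=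
  (∀ v, G.l v ≠ none) ∧ (∀ v, G.p v ≠ none)

/-- Graph morphisms preserve sources, targets, edge labels, and those node labels and rootedness
values that are defined. -/
structure Hom (G H : RGraph LV LE) where
  onV : G.V → H.V
  onE : G.E → H.E
  map_s : ∀ e, onV (G.s e) = H.s (onE e)
  map_t : ∀ e, onV (G.t e) = H.t (onE e)
  map_m : ∀ e, G.m e = H.m (onE e)
  map_l : ∀ v, G.l v ≠ none → G.l v = H.l (onV v)
  map_p : ∀ v, G.p v ≠ none → G.p v = H.p (onV v)

def Hom.Injective {G H : RGraph LV LE} (f : Hom G H) : Prop :=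
  Function.Injective f.onV ∧ Function.Injective f.onE

/-- Isomorphic graphs: there are mutually inverse morphisms. -/
def Isomorphic (G H : RGraph LV LE) : Prop :=
  ∃ (f : Hom G H) (g : Hom H G),
    Function.LeftInverse g.onV f.onV ∧ Function.RightInverse g.onV f.onV ∧
    Function.LeftInverse g.onE f.onE ∧ Function.RightInverse g.onE f.onE

/-- The number of vertices. -/
noncomputable def order (G : RGraph LV LE) : ℕ := Nat.card G.V

noncomputable def indeg (G : RGraph LV LE) (v : G.V) : ℕ := Nat.card {e : G.E // G.t e = v}

noncomputable def outdeg (G : RGraph LV LE) (v : G.V) : ℕ := Nat.card {e : G.E // G.s e = v}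

/-- The degree of a vertex; a loop counts twice. -/
noncomputable def deg (G : RGraph LV LE) (v : G.V) : ℕ := G.indeg v + G.outdeg v

/-- Every vertex has degree at most `b`. -/
def DegreeBounded (G : RGraph LV LE) (b : ℕ) : Prop := ∀ v, G.deg v ≤ b

/-- The children of a vertex: the targets of its outgoing edges. -/
def children (G : RGraph LV LE) (v : G.V) : Set G.V := {w | ∃ e, G.s e = v ∧ G.t e = w}

/-- `G.UWalk u v es`: the edge sequence `es` is an undirected walk from `u` to `v`. -/
inductive UWalk (G : RGraph LV LE) : G.V → G.V → List G.E → Prop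
  | nil (v : G.V) : UWalk G v v []
  | fwd (e : G.E) (w : G.V) (es : List G.E) :
      UWalk G (G.t e) w es → UWalk G (G.s e) w (e :: es)
  | bwd (e : G.E) (w : G.V) (es : List G.E) :
      UWalk G (G.s e) w es → UWalk G (G.t e) w (e :: es)

def Connected (G : RGraph LV LE) : Prop := ∀ u v, ∃ es, G.UWalk u v es

/-- There is an undirected cycle: a closed undirected walk with at least one edge that uses no edge
twice. Loops and pairs of parallel edges are such cycles. -/
def HasUCycle (G : RGraph LV LE) : Prop :=
  ∃ (v : G.V) (es : List G.E), es ≠ [] ∧ es.Nodup ∧ G.UWalk v v es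

def IsTree (G : RGraph LV LE) : Prop :=
  Nonempty G.V ∧ G.Connected ∧ ¬ G.HasUCycle ∧ ∀ v, G.indeg v ≤ 1

def IsBinaryTree (G : RGraph LV LE) : Prop := G.IsTree ∧ ∀ v, G.outdeg v ≤ 2

def IsFullBinaryTree (G : RGraph LV LE) : Prop :=
  G.IsBinaryTree ∧ ∀ v, (G.children v).ncard = 0 ∨ (G.children v).ncard = 2

end RGraph

/-! ## Rules and derivations -/

/-- A rule `L ← K → R`: `L` and `R` are totally labelled and totally rooted, the interface `K` may
be partially labelled and rooted, and both maps are injective morphisms. -/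
structure RRule (LV LE : Type) where
  L : RGraph LV LE
  K : RGraph LV LE
  R : RGraph LV LE
  left : RGraph.Hom K L
  right : RGraph.Hom K R
  left_inj : left.Injective
  right_inj : right.Injective
  L_total : L.IsTLRG
  R_total : R.IsTLRG

namespace RRule

variable {LV LE : Type}

/-- A match of `r` in `G`: an injective morphism `L → G` such that no edge of `G` outside the image
of `L` is incident to the image of a node of `L` outside `K` (the dangling condition). -/
structure Match (r : RRule LV LE) (G : RGraph LV LE) where
  g : RGraph.Hom r.L G
  inj : g.Injective
  dangling : ∀ e : G.E, e ∉ Set.range g.onE → ∀ x : r.L.V, x ∉ Set.range r.left.onV →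
    G.s e ≠ g.onV x ∧ G.t e ≠ g.onV x

namespace Match

variable {r : RRule LV LE} {G : RGraph LV LE} (M : r.Match G)

/-- The vertices in the image of `L` minus `K`. -/
def DelV (v : G.V) : Prop := ∃ x, x ∉ Set.range r.left.onV ∧ M.g.onV x = v

/-- The edges in the image of `L` minus `K`. -/
def DelE (e : G.E) : Prop := ∃ x, x ∉ Set.range r.left.onE ∧ M.g.onE x = e

/-- The vertex of `G` that is the image of a vertex of the interface. -/
def ofK (k : r.K.V) : G.V := M.g.onV (r.left.onV k)

theorem not_delV_ofK (k : r.K.V) : ¬ M.DelV (M.ofK k) := by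
  rintro ⟨x, hx, h⟩
  exact hx ⟨k, (M.inj.1 h).symm⟩

theorem not_delV_s (e : G.E) (he : ¬ M.DelE e) : ¬ M.DelV (G.s e) := by
  rintro ⟨x, hx, h⟩
  by_cases hr : e ∈ Set.range M.g.onE
  · obtain ⟨y, rfl⟩ := hr
    by_cases hy : y ∈ Set.range r.left.onE
    · obtain ⟨k, rfl⟩ := hy
      rw [← M.g.map_s, ← r.left.map_s] at h
      exact hx ⟨_, (M.inj.1 h).symm⟩
    · exact he ⟨y, hy, rfl⟩
  · exact (M.dangling e hr x hx).1 h.symm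

theorem not_delV_t (e : G.E) (he : ¬ M.DelE e) : ¬ M.DelV (G.t e) := by
  rintro ⟨x, hx, h⟩
  by_cases hr : e ∈ Set.range M.g.onE
  · obtain ⟨y, rfl⟩ := hr
    by_cases hy : y ∈ Set.range r.left.onE
    · obtain ⟨k, rfl⟩ := hy
      rw [← M.g.map_t, ← r.left.map_t] at h
      exact hx ⟨_, (M.inj.1 h).symm⟩
    · exact he ⟨y, hy, rfl⟩
  · exact (M.dangling e hr x hx).2 h.symm

open Classical in
/-- The intermediate graph: delete the image of `L` minus `K`, and make the images of unlabelled
nodes of `K` unlabelled and of nodes of `K` with undefined rootedness undefined in rootedness. -/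
noncomputable def intermediate : RGraph LV LE where
  V := {v : G.V // ¬ M.DelV v}
  E := {e : G.E // ¬ M.DelE e}
  finV := by
    have := G.finV
    infer_instance
  finE := by
    have := G.finE
    infer_instance
  s e := ⟨G.s e.1, M.not_delV_s e.1 e.2⟩
  t e := ⟨G.t e.1, M.not_delV_t e.1 e.2⟩
  l v := if ∃ k, r.K.l k = none ∧ M.ofK k = v.1 then none else G.l v.1
  m e := G.m e.1
  p v := if ∃ k, r.K.p k = none ∧ M.ofK k = v.1 then none else G.p v.1

open Classical in
/-- The vertex of the result graph to which a vertex of `R` is sent. -/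
noncomputable def comatchV (x : r.R.V) :
    M.intermediate.V ⊕ {x : r.R.V // x ∉ Set.range r.right.onV} :=
  if h : ∃ k, r.right.onV k = x then Sum.inl ⟨M.ofK h.choose, M.not_delV_ofK _⟩
  else Sum.inr ⟨x, h⟩

open Classical in
/-- The result graph: add `R` minus `K` disjointly to the intermediate graph, and give the images of
the unlabelled nodes of `K` (and those with undefined rootedness) the label (the rootedness) they
have in `R`. -/
noncomputable def result : RGraph LV LE where
  V := M.intermediate.V ⊕ {x : r.R.V // x ∉ Set.range r.right.onV}
  E := M.intermediate.E ⊕ {x : r.R.E // x ∉ Set.range r.right.onE}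
  finV := by
    have := M.intermediate.finV
    have := r.R.finV
    infer_instance
  finE := by
    have := M.intermediate.finE
    have := r.R.finE
    infer_instance
  s := Sum.elim (fun e => Sum.inl (M.intermediate.s e)) (fun e => M.comatchV (r.R.s e.1))
  t := Sum.elim (fun e => Sum.inl (M.intermediate.t e)) (fun e => M.comatchV (r.R.t e.1))
  l := Sum.elim
    (fun v => if h : ∃ k, r.K.l k = none ∧ M.ofK k = v.1 then r.R.l (r.right.onV h.choose)
      else M.intermediate.l v)
    (fun x => r.R.l x.1)
  m := Sum.elim M.intermediate.m (fun e => r.R.m e.1)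
  p := Sum.elim
    (fun v => if h : ∃ k, r.K.p k = none ∧ M.ofK k = v.1 then r.R.p (r.right.onV h.choose)
      else M.intermediate.p v)
    (fun x => r.R.p x.1)

end Match

end RRule

namespace RGraph

variable {LV LE : Type}

/-- `H` is directly derived from the totally labelled, totally rooted graph `G` by one of the rules
in `rules`; results are taken up to isomorphism. -/
def DirectlyDerives (rules : Set (RRule LV LE)) (G H : RGraph LV LE) : Prop :=
  G.IsTLRG ∧ ∃ r ∈ rules, ∃ M : r.Match G, M.result.Isomorphic H

/-- `DerivesIn rules n G H`: there is a derivation of length `n` from `G` to `H`. -/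
inductive DerivesIn (rules : Set (RRule LV LE)) : ℕ → RGraph LV LE → RGraph LV LE → Prop
  | zero {G H : RGraph LV LE} : G.Isomorphic H → DerivesIn rules 0 G H
  | succ {n : ℕ} {G H H' : RGraph LV LE} :
      DerivesIn rules n G H → DirectlyDerives rules H H' → DerivesIn rules (n + 1) G H'

def Derives (rules : Set (RRule LV LE)) (G H : RGraph LV LE) : Prop := ∃ n, DerivesIn rules n G H

def InNormalForm (rules : Set (RRule LV LE)) (H : RGraph LV LE) : Prop :=
  ∀ H', ¬ DirectlyDerives rules H H'

/-- `H` is a normal form of `G`. -/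
def IsNormalFormOf (rules : Set (RRule LV LE)) (H G : RGraph LV LE) : Prop :=
  Derives rules G H ∧ InNormalForm rules H

end RGraph

/-! ## The full binary tree system -/

/-- Node labels: the square and the triangle. -/
inductive NLabel
  | box
  | tri
  deriving DecidableEq

/-- Edge labels: only the square. -/
inductive ELabel
  | box
  deriving DecidableEq

/-- The graph with vertices `Fin n` and edges `Fin k`, all edges labelled by the square. -/
def finRGraph (n k : ℕ) (s t : Fin k → Fin n) (l : Fin n → Option NLabel)
    (p : Fin n → Option Bool) : RGraph NLabel ELabel where
  V := Fin n
  E := Fin k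
  finV := inferInstance
  finE := inferInstance
  s := s
  t := t
  l := l
  m := fun _ => ELabel.box
  p := p

/-- The interface with `n` unlabelled nodes of undefined rootedness and without edges. -/
def blankRGraph (n : ℕ) : RGraph NLabel ELabel :=
  finRGraph n 0 Fin.elim0 Fin.elim0 (fun _ => none) (fun _ => none)

/-- Morphisms out of a blank interface are arbitrary maps of nodes. -/
def blankHom {n : ℕ} (G : RGraph NLabel ELabel) (f : Fin n → G.V) :
    RGraph.Hom (blankRGraph n) G where
  onV := f
  onE := fun e => Fin.elim0 e
  map_s := fun e => Fin.elim0 e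
  map_t := fun e => Fin.elim0 e
  map_m := fun e => Fin.elim0 e
  map_l := fun _ h => absurd rfl h
  map_p := fun _ h => absurd rfl h

theorem blankHom_injective {n : ℕ} (G : RGraph NLabel ELabel) (f : Fin n → G.V)
    (hf : Function.Injective f) : (blankHom G f).Injective :=
  ⟨hf, fun e => Fin.elim0 e⟩

/-- A rule with blank interface on the nodes `0, …, n - 1`, which keep their number on both sides.
-/
def blankRule (n a b c d : ℕ) (hL : n ≤ a) (hR : n ≤ c)
    (sL tL : Fin b → Fin a) (lL : Fin a → NLabel) (pL : Fin a → Bool)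
    (sR tR : Fin d → Fin c) (lR : Fin c → NLabel) (pR : Fin c → Bool) :
    RRule NLabel ELabel where
  L := finRGraph a b sL tL (fun v => some (lL v)) (fun v => some (pL v))
  K := blankRGraph n
  R := finRGraph c d sR tR (fun v => some (lR v)) (fun v => some (pR v))
  left := blankHom _ (Fin.castLE hL)
  right := blankHom _ (Fin.castLE hR)
  left_inj := blankHom_injective _ _ (Fin.castLE_injective hL)
  right_inj := blankHom_injective _ _ (Fin.castLE_injective hR)
  L_total := ⟨fun _ => Option.some_ne_none _, fun _ => Option.some_ne_none _⟩
  R_total := ⟨fun _ => Option.some_ne_none _, fun _ => Option.some_ne_none _⟩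

namespace FBT

open NLabel

/-- Left: a rooted square with two unrooted square children. Empty interface. Right: a rooted
square. -/
def r0 : RRule NLabel ELabel :=
  blankRule 0 3 2 1 0 (by decide) (by decide)
    ![0, 0] ![1, 2] ![box, box, box] ![true, false, false]
    ![] ![] ![box] ![true]

/-- Left: an unrooted node `0` labelled `x`, its child, a rooted square, and two unrooted square
children of the latter. Interface: the node `0`. Right: the node `0`, now a rooted square, with an
unrooted square child. -/
def prune (x : NLabel) : RRule NLabel ELabel :=
  blankRule 1 4 3 2 1 (by decide) (by decide)
    ![0, 1, 1] ![1, 2, 3] ![x, box, box, box] ![false, true, false, false]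
    ![0] ![1] ![box, box] ![true, false]

def r1 : RRule NLabel ELabel := prune box

def r2 : RRule NLabel ELabel := prune tri

/-- A directed path `0 → 1 → 2` of squares; the root moves from `0` to `1`, and `0` becomes a
triangle. Interface: all three nodes. -/
def r3 : RRule NLabel ELabel :=
  blankRule 3 3 2 3 2 (by decide) (by decide)
    ![0, 1] ![1, 2] ![box, box, box] ![true, false, false]
    ![0, 1] ![1, 2] ![tri, box, box] ![false, true, false]

/-- An edge `0 → 1` between squares; the root moves from `1` to `0`. Interface: the node `0`. -/
def r4 : RRule NLabel ELabel :=
  blankRule 1 2 1 2 1 (by decide) (by decide)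
    ![0] ![1] ![box, box] ![false, true]
    ![0] ![1] ![box, box] ![true, false]

def rules : Set (RRule NLabel ELabel) := {r0, r1, r2, r3, r4}

/-- The graph with a single node, a rooted square, and no edges. -/
def single : RGraph NLabel ELabel :=
  finRGraph 1 0 Fin.elim0 Fin.elim0 (fun _ => some box) (fun _ => some true)

/-- Input graphs: exactly one root, and all nodes and edges labelled by the square. -/
def IsInput (G : RGraph NLabel ELabel) : Prop :=
  G.IsTLRG ∧ (∃! v, G.p v = some true) ∧ (∀ v, G.l v = some box) ∧ ∀ e, G.m e = ELabel.box

/-- The underlying unlabelled graph: every node unrooted, everything labelled by the square. -/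
def unlabelled (G : RGraph NLabel ELabel) : RGraph NLabel ELabel where
  V := G.V
  E := G.E
  finV := G.finV
  finE := G.finE
  s := G.s
  t := G.t
  l := fun _ => some box
  m := fun _ => ELabel.box
  p := fun _ => some false

end FBT

/-! ## A step-counting machine on stored graphs

A stored graph has natural numbers as names of nodes and edges. A program is a finite command over
finitely many node registers, edge registers and Boolean flags; it cannot compute with names, only
follow them and test them for equality. Elementary operations take one step, except that changing
the label or the rootedness of a node costs one further step for each rooted node (the lists of
rooted nodes are kept in the order of their names; new names are always the largest ones). Listing a
set of nodes or edges takes a number of steps linear in the size of the set (for unrooted nodes: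
linear in the number of all nodes). -/

namespace GraphMachine

/-- A graph in memory. The functions are only meaningful on the present nodes and edges. -/
structure Store (LV LE : Type) where
  nodes : Finset ℕ
  edges : Finset ℕ
  src : ℕ → ℕ
  tgt : ℕ → ℕ
  lab : ℕ → LV
  edgeLab : ℕ → LE
  root : ℕ → Bool

namespace Store

variable {LV LE : Type}

/-- The store holds a copy of `G`, under arbitrary names. -/
def Represents (S : Store LV LE) (G : RGraph LV LE) : Prop :=
  ∃ (f : G.V → ℕ) (h : G.E → ℕ), Function.Injective f ∧ Function.Injective h ∧
    Set.range f = ↑S.nodes ∧ Set.range h = ↑S.edges ∧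
    (∀ e, S.src (h e) = f (G.s e)) ∧ (∀ e, S.tgt (h e) = f (G.t e)) ∧
    (∀ e, S.edgeLab (h e) = G.m e) ∧
    (∀ v, G.l v = some (S.lab (f v))) ∧ (∀ v, G.p v = some (S.root (f v)))

/-- The edges with source `v`, in the order of their names. -/
def outEdges (S : Store LV LE) (v : ℕ) : List ℕ :=
  (S.edges.filter (fun e => S.src e = v)).sort (· ≤ ·)

/-- The edges with target `v`, in the order of their names. -/
def inEdges (S : Store LV LE) (v : ℕ) : List ℕ :=
  (S.edges.filter (fun e => S.tgt e = v)).sort (· ≤ ·)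

/-- The nodes with label `a` and rootedness `b`, in the order of their names. -/
def nodesWith [DecidableEq LV] (S : Store LV LE) (a : LV) (b : Bool) : List ℕ :=
  (S.nodes.filter (fun v => S.lab v = a ∧ S.root v = b)).sort (· ≤ ·)

/-- The number of rooted nodes. -/
def numRooted (S : Store LV LE) : ℕ := (S.nodes.filter (fun v => S.root v = true)).card

/-- A name larger than all names in use. -/
def fresh (A : Finset ℕ) : ℕ := A.sup id + 1

end Store

/-- The atomic tests; arguments are indices of registers or flags, labels, and numerals. -/
inductive Test (LV LE : Type)
  | flag (b : ℕ)
  | sameNode (x y : ℕ)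
  | sameEdge (e f : ℕ)
  | hasLabel (x : ℕ) (a : LV)
  | hasEdgeLabel (e : ℕ) (a : LE)
  | isRoot (x : ℕ)
  | indegEq (x k : ℕ)
  | outdegEq (x k : ℕ)
  | numNodesEq (k : ℕ)
  | numEdgesEq (k : ℕ)

/-- The commands; arguments `x y` are node registers, `e` is an edge register, `b` a flag. -/
inductive Cmd (LV LE : Type)
  | skip
  | setFlag (b : ℕ) (c : Bool)
  | copyNode (x y : ℕ)
  | copyEdge (e f : ℕ)
  | source (x e : ℕ)
  | target (x e : ℕ)
  | relabel (x : ℕ) (a : LV)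
  | setRoot (x : ℕ) (c : Bool)
  | newNode (x : ℕ) (a : LV) (c : Bool)
  | newEdge (e x y : ℕ) (a : LE)
  | delNode (x : ℕ)
  | delEdge (e : ℕ)
  | seq (P Q : Cmd LV LE)
  | ite (T : Test LV LE) (P Q : Cmd LV LE)
  | while (T : Test LV LE) (P : Cmd LV LE)
  | forNodes (x : ℕ) (a : LV) (c : Bool) (P : Cmd LV LE)
  | forOut (e x : ℕ) (P : Cmd LV LE)
  | forIn (e x : ℕ) (P : Cmd LV LE)

/-- A machine state: the stored graph and the contents of the registers and flags. -/
structure State (LV LE : Type) where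
  store : Store LV LE
  nreg : ℕ → ℕ
  ereg : ℕ → ℕ
  flag : ℕ → Bool

namespace State

variable {LV LE : Type}

def setNode (σ : State LV LE) (x v : ℕ) : State LV LE :=
  { σ with nreg := Function.update σ.nreg x v }

def setEdge (σ : State LV LE) (e v : ℕ) : State LV LE :=
  { σ with ereg := Function.update σ.ereg e v }

end State

def Test.Holds {LV LE : Type} (σ : State LV LE) : Test LV LE → Prop
  | .flag b => σ.flag b = true
  | .sameNode x y => σ.nreg x = σ.nreg y
  | .sameEdge e f => σ.ereg e = σ.ereg f
  | .hasLabel x a => σ.store.lab (σ.nreg x) = a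
  | .hasEdgeLabel e a => σ.store.edgeLab (σ.ereg e) = a
  | .isRoot x => σ.store.root (σ.nreg x) = true
  | .indegEq x k => (σ.store.inEdges (σ.nreg x)).length = k
  | .outdegEq x k => (σ.store.outEdges (σ.nreg x)).length = k
  | .numNodesEq k => σ.store.nodes.card = k
  | .numEdgesEq k => σ.store.edges.card = k

/-- The time to list the nodes of a given label and rootedness `c`: linear in the size of the list
for rooted nodes, linear in the number of all nodes for unrooted ones. -/
def listTime {LV LE : Type} [DecidableEq LV] (S : Store LV LE) (a : LV) (c : Bool) : ℕ :=
  if c then (S.nodesWith a c).length else S.nodes.card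

mutual

/-- `Exec P σ t σ'`: started in the state `σ`, the command `P` halts in the state `σ'` after exactly
`t` steps. The semantics is deterministic. Updates of absent nodes or edges, and the deletion of a
node that is incident to an edge, are not executable. Loops over a set of nodes or edges use the
list as it is when the loop is entered. -/
inductive Exec {LV LE : Type} [DecidableEq LV] :
    Cmd LV LE → State LV LE → ℕ → State LV LE → Prop
  | skip (σ : State LV LE) : Exec .skip σ 1 σ
  | setFlag (σ : State LV LE) (b : ℕ) (c : Bool) :
      Exec (.setFlag b c) σ 1 { σ with flag := Function.update σ.flag b c }
  | copyNode (σ : State LV LE) (x y : ℕ) :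
      Exec (.copyNode x y) σ 1 (σ.setNode x (σ.nreg y))
  | copyEdge (σ : State LV LE) (e f : ℕ) :
      Exec (.copyEdge e f) σ 1 (σ.setEdge e (σ.ereg f))
  | source (σ : State LV LE) (x e : ℕ) :
      Exec (.source x e) σ 1 (σ.setNode x (σ.store.src (σ.ereg e)))
  | target (σ : State LV LE) (x e : ℕ) :
      Exec (.target x e) σ 1 (σ.setNode x (σ.store.tgt (σ.ereg e)))
  | relabel (σ : State LV LE) (x : ℕ) (a : LV) :
      σ.nreg x ∈ σ.store.nodes →
      Exec (.relabel x a) σ (1 + σ.store.numRooted)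
        { σ with store :=
          { σ.store with lab := Function.update σ.store.lab (σ.nreg x) a } }
  | setRoot (σ : State LV LE) (x : ℕ) (c : Bool) :
      σ.nreg x ∈ σ.store.nodes →
      Exec (.setRoot x c) σ (1 + σ.store.numRooted)
        { σ with store :=
          { σ.store with root := Function.update σ.store.root (σ.nreg x) c } }
  | newNode (σ : State LV LE) (x : ℕ) (a : LV) (c : Bool) (v : ℕ) :
      v = Store.fresh σ.store.nodes →
      Exec (.newNode x a c) σ 1
        { σ with
          nreg := Function.update σ.nreg x v
          store :=
            { σ.store with
              nodes := insert v σ.store.nodes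
              lab := Function.update σ.store.lab v a
              root := Function.update σ.store.root v c } }
  | newEdge (σ : State LV LE) (e x y : ℕ) (a : LE) (d : ℕ) :
      d = Store.fresh σ.store.edges →
      σ.nreg x ∈ σ.store.nodes → σ.nreg y ∈ σ.store.nodes →
      Exec (.newEdge e x y a) σ 1
        { σ with
          ereg := Function.update σ.ereg e d
          store :=
            { σ.store with
              edges := insert d σ.store.edges
              src := Function.update σ.store.src d (σ.nreg x)
              tgt := Function.update σ.store.tgt d (σ.nreg y)
              edgeLab := Function.update σ.store.edgeLab d a } }
  | delNode (σ : State LV LE) (x : ℕ) :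
      σ.nreg x ∈ σ.store.nodes →
      (∀ d ∈ σ.store.edges, σ.store.src d ≠ σ.nreg x ∧ σ.store.tgt d ≠ σ.nreg x) →
      Exec (.delNode x) σ 1
        { σ with store := { σ.store with nodes := σ.store.nodes.erase (σ.nreg x) } }
  | delEdge (σ : State LV LE) (e : ℕ) :
      σ.ereg e ∈ σ.store.edges →
      Exec (.delEdge e) σ 1
        { σ with store := { σ.store with edges := σ.store.edges.erase (σ.ereg e) } }
  | seq (P Q : Cmd LV LE) (σ σ' σ'' : State LV LE) (t t' : ℕ) :
      Exec P σ t σ' → Exec Q σ' t' σ'' → Exec (.seq P Q) σ (t + t') σ''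
  | iteTrue (T : Test LV LE) (P Q : Cmd LV LE) (σ σ' : State LV LE) (t : ℕ) :
      T.Holds σ → Exec P σ t σ' → Exec (.ite T P Q) σ (1 + t) σ'
  | iteFalse (T : Test LV LE) (P Q : Cmd LV LE) (σ σ' : State LV LE) (t : ℕ) :
      ¬ T.Holds σ → Exec Q σ t σ' → Exec (.ite T P Q) σ (1 + t) σ'
  | whileTrue (T : Test LV LE) (P : Cmd LV LE) (σ σ' σ'' : State LV LE) (t t' : ℕ) :
      T.Holds σ → Exec P σ t σ' → Exec (.while T P) σ' t' σ'' →
      Exec (.while T P) σ (1 + t + t') σ''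
  | whileFalse (T : Test LV LE) (P : Cmd LV LE) (σ : State LV LE) :
      ¬ T.Holds σ → Exec (.while T P) σ 1 σ
  | forNodes (x : ℕ) (a : LV) (c : Bool) (P : Cmd LV LE) (σ σ' : State LV LE) (t : ℕ) :
      ExecNodes x P (σ.store.nodesWith a c) σ t σ' →
      Exec (.forNodes x a c P) σ (1 + listTime σ.store a c + t) σ'
  | forOut (e x : ℕ) (P : Cmd LV LE) (σ σ' : State LV LE) (t : ℕ) :
      ExecEdges e P (σ.store.outEdges (σ.nreg x)) σ t σ' →
      Exec (.forOut e x P) σ (1 + (σ.store.outEdges (σ.nreg x)).length + t) σ'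
  | forIn (e x : ℕ) (P : Cmd LV LE) (σ σ' : State LV LE) (t : ℕ) :
      ExecEdges e P (σ.store.inEdges (σ.nreg x)) σ t σ' →
      Exec (.forIn e x P) σ (1 + (σ.store.inEdges (σ.nreg x)).length + t) σ'

/-- Execute `P` once for each entry of a list, with the entry in the node register `x`. -/
inductive ExecNodes {LV LE : Type} [DecidableEq LV] :
    ℕ → Cmd LV LE → List ℕ → State LV LE → ℕ → State LV LE → Prop
  | nil (x : ℕ) (P : Cmd LV LE) (σ : State LV LE) : ExecNodes x P [] σ 0 σ
  | cons (x : ℕ) (P : Cmd LV LE) (v : ℕ) (vs : List ℕ) (σ σ' σ'' : State LV LE) (t t' : ℕ) :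
      Exec P (σ.setNode x v) t σ' → ExecNodes x P vs σ' t' σ'' →
      ExecNodes x P (v :: vs) σ (t + t') σ''

/-- Execute `P` once for each entry of a list, with the entry in the edge register `e`. -/
inductive ExecEdges {LV LE : Type} [DecidableEq LV] :
    ℕ → Cmd LV LE → List ℕ → State LV LE → ℕ → State LV LE → Prop
  | nil (e : ℕ) (P : Cmd LV LE) (σ : State LV LE) : ExecEdges e P [] σ 0 σ
  | cons (e : ℕ) (P : Cmd LV LE) (d : ℕ) (ds : List ℕ) (σ σ' σ'' : State LV LE) (t t' : ℕ) :
      Exec P (σ.setEdge e d) t σ' → ExecEdges e P ds σ' t' σ'' →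
      ExecEdges e P (d :: ds) σ (t + t') σ''

end

/-- Raise the flag `0`, then repeat `B` as long as this flag is up. -/
def loop {LV LE : Type} (B : Cmd LV LE) : Cmd LV LE :=
  .seq (.setFlag 0 true) (.while (.flag 0) B)

/-- On every stored copy of `H` and for all register contents, `B` halts within `k` steps; it either
replaces `H` by a graph directly derived from it and leaves the flag `0` up, or, if `H` is in normal
form, leaves `H` in the store and takes the flag `0` down. -/
def PerformsStepWithin {LV LE : Type} [DecidableEq LV] (rules : Set (RRule LV LE))
    (B : Cmd LV LE) (k : ℕ) (H : RGraph LV LE) : Prop :=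
  ∀ σ : State LV LE, σ.store.Represents H →
    ∃ (t : ℕ) (σ' : State LV LE), Exec B σ t σ' ∧ t ≤ k ∧
      ((σ'.flag 0 = true ∧ ∃ H', H.DirectlyDerives rules H' ∧ σ'.store.Represents H') ∨
       (σ'.flag 0 = false ∧ H.InNormalForm rules ∧ σ'.store.Represents H))

end GraphMachine

/-!
The only root walks down along paths of squares, leaving triangles behind, removes pairs of sibling
leaves, and climbs back up. Every rule application is thus a *move* at the root: an edit of the
graph that deletes at most two leaves, relabels one node and shifts the root along at most one edge.

From every triangle a directed path leads to the root, and after every step the root has an outgoing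
edge or no incoming edge. Every step lowers the number of squares, except possibly a first one
upwards, from a root that has no outgoing but an incoming edge. Hence derivations from `G` have
length at most `|V| + 1`.

Moves delete leaves only in pairs of siblings, so being a full binary tree is preserved in both
directions. In a full binary tree the nodes below the root are squares, as a triangle there would
close a directed cycle. If the root has a grandchild, it starts a path of squares; if it only has
children, they are removable; if it has no children but a parent, it can climb. Hence a normal form
that is a full binary tree consists of a single node.

The root is found in constant time because it is the only one, and a redex at the root is found in
constant time because the degrees are bounded.
-/

/-! ## Isomorphisms, edits and reducts -/

namespace RGraph

variable {LV LE : Type} {G H H' : RGraph LV LE}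

/-- Isomorphisms as pairs of bijections that also preserve undefined labels and undefined
rootedness. -/
structure Iso (G H : RGraph LV LE) where
  onV : G.V ≃ H.V
  onE : G.E ≃ H.E
  map_s : ∀ e, onV (G.s e) = H.s (onE e)
  map_t : ∀ e, onV (G.t e) = H.t (onE e)
  map_m : ∀ e, G.m e = H.m (onE e)
  map_l : ∀ v, G.l v = H.l (onV v)
  map_p : ∀ v, G.p v = H.p (onV v)

namespace Iso

def refl (G : RGraph LV LE) : Iso G G where
  onV := Equiv.refl _
  onE := Equiv.refl _
  map_s _ := rfl
  map_t _ := rfl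
  map_m _ := rfl
  map_l _ := rfl
  map_p _ := rfl

theorem isomorphic (f : Iso G H) : G.Isomorphic H := by
  refine ⟨⟨f.onV, f.onE, f.map_s, f.map_t, f.map_m, fun v _ => f.map_l v, fun v _ => f.map_p v⟩,
    ⟨f.onV.symm, f.onE.symm, fun e => ?_, fun e => ?_, fun e => ?_, fun v _ => ?_, fun v _ => ?_⟩,
    f.onV.left_inv, f.onV.right_inv, f.onE.left_inv, f.onE.right_inv⟩
  · rw [Equiv.symm_apply_eq, f.map_s, Equiv.apply_symm_apply]
  · rw [Equiv.symm_apply_eq, f.map_t, Equiv.apply_symm_apply]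
  · rw [f.map_m, Equiv.apply_symm_apply]
  · rw [f.map_l, Equiv.apply_symm_apply]
  · rw [f.map_p, Equiv.apply_symm_apply]

end Iso

theorem Isomorphic.exists_iso (hG : G.IsTLRG) : G.Isomorphic H → Nonempty (Iso G H)
  | ⟨f, g, hV, hV', hE, hE'⟩ =>
    ⟨{ onV := ⟨f.onV, g.onV, hV, hV'⟩
       onE := ⟨f.onE, g.onE, hE, hE'⟩
       map_s := f.map_s
       map_t := f.map_t
       map_m := f.map_m
       map_l := fun v => f.map_l v (hG.1 v)
       map_p := fun v => f.map_p v (hG.2 v) }⟩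

/-- Instructions to delete some vertices and edges of a graph and to relabel the other vertices. A
rule whose right-hand side embeds into its left-hand side acts on a graph in this way. -/
structure Edit (G : RGraph LV LE) where
  delV : Set G.V
  delE : Set G.E
  l : G.V → Option LV
  p : G.V → Option Bool

namespace Edit

/-- `X.Reduct H` exhibits `H` as the outcome of the edit `X`, by means of maps from `H` back to the
edited graph. -/
structure Reduct (X : Edit G) (H : RGraph LV LE) where
  onV : H.V → G.V
  onE : H.E → G.E
  injV : Function.Injective onV
  injE : Function.Injective onE
  range_onV : Set.range onV = X.delVᶜ
  range_onE : Set.range onE = X.delEᶜ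
  map_s : ∀ e, onV (H.s e) = G.s (onE e)
  map_t : ∀ e, onV (H.t e) = G.t (onE e)
  map_m : ∀ e, H.m e = G.m (onE e)
  map_l : ∀ v, H.l v = X.l (onV v)
  map_p : ∀ v, H.p v = X.p (onV v)

namespace Reduct

variable {X : Edit G} (R : X.Reduct H)

include R

theorem onV_notMem (w : H.V) : R.onV w ∉ X.delV := by
  rw [← Set.mem_compl_iff, ← R.range_onV]
  exact Set.mem_range_self w

theorem onE_notMem (e : H.E) : R.onE e ∉ X.delE := by
  rw [← Set.mem_compl_iff, ← R.range_onE]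
  exact Set.mem_range_self e

theorem exists_onV_eq {v : G.V} (hv : v ∉ X.delV) : ∃ w, R.onV w = v := by
  rwa [← Set.mem_compl_iff, ← R.range_onV] at hv

theorem exists_onE_eq {e : G.E} (he : e ∉ X.delE) : ∃ e', R.onE e' = e := by
  rwa [← Set.mem_compl_iff, ← R.range_onE] at he

omit R in
/-- An edit determines its outcome up to isomorphism. -/
noncomputable def iso (R : X.Reduct H) (R' : X.Reduct H') : Iso H H' where
  onV := (Equiv.ofInjective _ R.injV).trans
    ((Equiv.setCongr (R.range_onV.trans R'.range_onV.symm)).trans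
      (Equiv.ofInjective _ R'.injV).symm)
  onE := (Equiv.ofInjective _ R.injE).trans
    ((Equiv.setCongr (R.range_onE.trans R'.range_onE.symm)).trans
      (Equiv.ofInjective _ R'.injE).symm)
  map_s e := R'.injV (by simp [R.map_s, R'.map_s, Equiv.apply_ofInjective_symm])
  map_t e := R'.injV (by simp [R.map_t, R'.map_t, Equiv.apply_ofInjective_symm])
  map_m e := by simp [R.map_m, R'.map_m, Equiv.apply_ofInjective_symm]
  map_l v := by simp [R.map_l, R'.map_l, Equiv.apply_ofInjective_symm]
  map_p v := by simp [R.map_p, R'.map_p, Equiv.apply_ofInjective_symm]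

/-- A graph isomorphic to the outcome of an edit is an outcome of this edit. -/
def transIso (f : Iso H H') : X.Reduct H' where
  onV := R.onV ∘ f.onV.symm
  onE := R.onE ∘ f.onE.symm
  injV := R.injV.comp f.onV.symm.injective
  injE := R.injE.comp f.onE.symm.injective
  range_onV := (f.onV.symm.surjective.range_comp _).trans R.range_onV
  range_onE := (f.onE.symm.surjective.range_comp _).trans R.range_onE
  map_s e := by
    obtain ⟨e, rfl⟩ := f.onE.surjective e
    simp [← f.map_s, R.map_s]
  map_t e := by
    obtain ⟨e, rfl⟩ := f.onE.surjective e
    simp [← f.map_t, R.map_t]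
  map_m e := by
    obtain ⟨e, rfl⟩ := f.onE.surjective e
    simp [← f.map_m, R.map_m]
  map_l v := by
    obtain ⟨v, rfl⟩ := f.onV.surjective v
    simp [← f.map_l, R.map_l]
  map_p v := by
    obtain ⟨v, rfl⟩ := f.onV.surjective v
    simp [← f.map_p, R.map_p]

end Reduct

/-- The edit that leaves everything unchanged. -/
def unchanged (G : RGraph LV LE) : Edit G where
  delV := ∅
  delE := ∅
  l := G.l
  p := G.p

/-- Every graph is an outcome of leaving it unchanged. -/
def unchangedReduct (G : RGraph LV LE) : (unchanged G).Reduct G where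
  onV := id
  onE := id
  injV := Function.injective_id
  injE := Function.injective_id
  range_onV := by simp [unchanged]
  range_onE := by simp [unchanged]
  map_s _ := rfl
  map_t _ := rfl
  map_m _ := rfl
  map_l _ := rfl
  map_p _ := rfl

/-- No edge that stays is incident to a vertex that is deleted. -/
def NoDangling (X : Edit G) : Prop := ∀ e ∉ X.delE, G.s e ∉ X.delV ∧ G.t e ∉ X.delV

theorem NoDangling.exists_reduct {X : Edit G} (hX : X.NoDangling) :
    ∃ H : RGraph LV LE, Nonempty (X.Reduct H) :=
  ⟨{ V := {v // v ∉ X.delV}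
     E := {e // e ∉ X.delE}
     finV := have := G.finV; inferInstance
     finE := have := G.finE; inferInstance
     s := fun e => ⟨G.s e, (hX e e.2).1⟩
     t := fun e => ⟨G.t e, (hX e e.2).2⟩
     l := fun v => X.l v
     m := fun e => G.m e
     p := fun v => X.p v },
   ⟨{ onV := Subtype.val
      onE := Subtype.val
      injV := Subtype.val_injective
      injE := Subtype.val_injective
      range_onV := Subtype.range_val
      range_onE := Subtype.range_val
      map_s := fun _ => rfl
      map_t := fun _ => rfl
      map_m := fun _ => rfl
      map_l := fun _ => rfl
      map_p := fun _ => rfl }⟩⟩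

end Edit

end RGraph

/-! ## Rules whose right-hand side embeds into the left-hand side -/

namespace RRule

variable {LV LE : Type}

/-- An embedding over the interface of the right-hand side of a rule into its left-hand side; labels
and rootedness of vertices need not be preserved. -/
structure Embedding (r : RRule LV LE) where
  onV : r.R.V → r.L.V
  onE : r.R.E → r.L.E
  injV : Function.Injective onV
  injE : Function.Injective onE
  map_s : ∀ e, onV (r.R.s e) = r.L.s (onE e)
  map_t : ∀ e, onV (r.R.t e) = r.L.t (onE e)
  map_m : ∀ e, r.R.m e = r.L.m (onE e)
  onV_right : ∀ k, onV (r.right.onV k) = r.left.onV k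
  onE_right : ∀ k, onE (r.right.onE k) = r.left.onE k

namespace Match

variable {r : RRule LV LE} {G : RGraph LV LE} (M : r.Match G) (ι : r.Embedding)

theorem delV_onV_iff {x : r.L.V} : M.DelV (M.g.onV x) ↔ x ∉ Set.range r.left.onV :=
  ⟨fun ⟨_, hy, h⟩ => M.inj.1 h ▸ hy, fun h => ⟨x, h, rfl⟩⟩

theorem delE_onE_iff {x : r.L.E} : M.DelE (M.g.onE x) ↔ x ∉ Set.range r.left.onE :=
  ⟨fun ⟨_, hy, h⟩ => M.inj.2 h ▸ hy, fun h => ⟨x, h, rfl⟩⟩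

/-- The edit of the host graph that a rule performs at a match, given an embedding of its right-hand
side into its left-hand side. -/
noncomputable def edit : G.Edit where
  delV := M.g.onV '' (Set.range ι.onV)ᶜ
  delE := M.g.onE '' (Set.range ι.onE)ᶜ
  l := Function.extend (M.g.onV ∘ ι.onV) r.R.l G.l
  p := Function.extend (M.g.onV ∘ ι.onV) r.R.p G.p

/-- The vertex of the host graph that corresponds to a vertex of the result. -/
def resultV : M.result.V → G.V := Sum.elim Subtype.val (fun x => M.g.onV (ι.onV x.1))

/-- The edge of the host graph that corresponds to an edge of the result. -/
def resultE : M.result.E → G.E := Sum.elim Subtype.val (fun x => M.g.onE (ι.onE x.1))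

theorem delV_onV_of_notMem_right {x : r.R.V} (hx : x ∉ Set.range r.right.onV) :
    M.DelV (M.g.onV (ι.onV x)) := by
  rw [delV_onV_iff]
  rintro ⟨k, hk⟩
  exact hx ⟨k, ι.injV (by rw [ι.onV_right, hk])⟩

theorem delE_onE_of_notMem_right {x : r.R.E} (hx : x ∉ Set.range r.right.onE) :
    M.DelE (M.g.onE (ι.onE x)) := by
  rw [delE_onE_iff]
  rintro ⟨k, hk⟩
  exact hx ⟨k, ι.injE (by rw [ι.onE_right, hk])⟩

theorem resultV_injective : Function.Injective (M.resultV ι) := by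
  refine Function.Injective.sumElim Subtype.val_injective
    ((M.inj.1.comp ι.injV).comp Subtype.val_injective) fun v x h => v.2 ?_
  rw [h]
  exact M.delV_onV_of_notMem_right ι x.2

theorem resultE_injective : Function.Injective (M.resultE ι) := by
  refine Function.Injective.sumElim Subtype.val_injective
    ((M.inj.2.comp ι.injE).comp Subtype.val_injective) fun e x h => e.2 ?_
  rw [h]
  exact M.delE_onE_of_notMem_right ι x.2

theorem range_resultV : Set.range (M.resultV ι) = (M.edit ι).delVᶜ := by
  ext v
  simp only [edit, Set.mem_compl_iff, Set.mem_image, Set.mem_range, not_exists, not_and]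
  constructor
  · rintro ⟨⟨w, hw⟩ | ⟨x, hx⟩, rfl⟩ y hy
    · rintro rfl
      obtain ⟨k, rfl⟩ := not_not.1 (mt M.delV_onV_iff.2 hw)
      exact hy _ (ι.onV_right k)
    · exact fun h => hy x (M.inj.1 h).symm
  · intro h
    by_cases hv : M.DelV v
    · obtain ⟨y, hy, rfl⟩ := hv
      obtain ⟨x, rfl⟩ := not_forall_not.1 fun hn => h y hn rfl
      refine ⟨Sum.inr ⟨x, ?_⟩, rfl⟩
      rintro ⟨k, rfl⟩
      exact hy ⟨k, (ι.onV_right k).symm⟩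
    · exact ⟨Sum.inl ⟨v, hv⟩, rfl⟩

theorem range_resultE : Set.range (M.resultE ι) = (M.edit ι).delEᶜ := by
  ext e
  simp only [edit, Set.mem_compl_iff, Set.mem_image, Set.mem_range, not_exists, not_and]
  constructor
  · rintro ⟨⟨f, hf⟩ | ⟨x, hx⟩, rfl⟩ y hy
    · rintro rfl
      obtain ⟨k, rfl⟩ := not_not.1 (mt M.delE_onE_iff.2 hf)
      exact hy _ (ι.onE_right k)
    · exact fun h => hy x (M.inj.2 h).symm
  · intro h
    by_cases he : M.DelE e
    · obtain ⟨y, hy, rfl⟩ := he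
      obtain ⟨x, rfl⟩ := not_forall_not.1 fun hn => h y hn rfl
      refine ⟨Sum.inr ⟨x, ?_⟩, rfl⟩
      rintro ⟨k, rfl⟩
      exact hy ⟨k, (ι.onE_right k).symm⟩
    · exact ⟨Sum.inl ⟨e, he⟩, rfl⟩

theorem resultV_comatchV (x : r.R.V) : M.resultV ι (M.comatchV x) = M.g.onV (ι.onV x) := by
  unfold comatchV
  split_ifs with h
  · change M.g.onV (r.left.onV h.choose) = _
    rw [← ι.onV_right, h.choose_spec]
  · rfl

open Classical in
/-- The two-stage relabelling in the definitions of `intermediate` and `result`, for a single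
labelling function: `κ`, `ρ` and `γ` are the labels of the interface, of the right-hand side and of
the host graph. -/
theorem relabel_eq_extend {α : Type} {κ : r.K.V → Option α} {ρ : r.R.V → Option α}
    {γ : G.V → Option α} (hρ : ∀ k, κ k ≠ none → κ k = ρ (r.right.onV k))
    (hγ : ∀ k, κ k ≠ none → κ k = γ (M.ofK k)) {v : G.V} (hv : ¬ M.DelV v) :
    (if h : ∃ k, κ k = none ∧ M.ofK k = v then ρ (r.right.onV h.choose)
      else if ∃ k, κ k = none ∧ M.ofK k = v then none else γ v) =
      Function.extend (M.g.onV ∘ ι.onV) ρ γ v := by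
  have hinj : Function.Injective (M.g.onV ∘ ι.onV) := M.inj.1.comp ι.injV
  have hofK (k : r.K.V) : Function.extend (M.g.onV ∘ ι.onV) ρ γ (M.ofK k) = ρ (r.right.onV k) := by
    rw [ofK, ← ι.onV_right]
    exact hinj.extend_apply ρ γ _
  split_ifs with h
  · conv_rhs => rw [← h.choose_spec.2, hofK]
  · by_cases hK : ∃ k, M.ofK k = v
    · obtain ⟨k, rfl⟩ := hK
      have hk : κ k ≠ none := fun hk => h ⟨k, hk, rfl⟩
      rw [hofK, ← hρ k hk, ← hγ k hk]
    · refine (Function.extend_apply' _ _ _ ?_).symm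
      rintro ⟨x, rfl⟩
      obtain ⟨k, hk⟩ := not_not.1 (mt M.delV_onV_iff.2 hv)
      exact hK ⟨k, congrArg M.g.onV hk⟩

theorem result_l (w : M.result.V) : M.result.l w = (M.edit ι).l (M.resultV ι w) := by
  rcases w with ⟨v, hv⟩ | x
  · refine M.relabel_eq_extend ι r.right.map_l (fun k hk => ?_) hv
    have hk' := r.left.map_l k hk
    exact hk'.trans (M.g.map_l _ (hk' ▸ hk))
  · exact ((M.inj.1.comp ι.injV).extend_apply r.R.l G.l x.1).symm

theorem result_p (w : M.result.V) : M.result.p w = (M.edit ι).p (M.resultV ι w) := by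
  rcases w with ⟨v, hv⟩ | x
  · refine M.relabel_eq_extend ι r.right.map_p (fun k hk => ?_) hv
    have hk' := r.left.map_p k hk
    exact hk'.trans (M.g.map_p _ (hk' ▸ hk))
  · exact ((M.inj.1.comp ι.injV).extend_apply r.R.p G.p x.1).symm

/-- The result of a rule application as an outcome of the corresponding edit. -/
def resultReduct : (M.edit ι).Reduct M.result where
  onV := M.resultV ι
  onE := M.resultE ι
  injV := M.resultV_injective ι
  injE := M.resultE_injective ι
  range_onV := M.range_resultV ι
  range_onE := M.range_resultE ι
  map_s := by
    rintro (e | x)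
    · rfl
    · exact (M.resultV_comatchV ι _).trans ((congrArg _ (ι.map_s x.1)).trans (M.g.map_s _))
  map_t := by
    rintro (e | x)
    · rfl
    · exact (M.resultV_comatchV ι _).trans ((congrArg _ (ι.map_t x.1)).trans (M.g.map_t _))
  map_m := by
    rintro (e | x)
    · rfl
    · exact (ι.map_m x.1).trans (M.g.map_m _)
  map_l := M.result_l ι
  map_p := M.result_p ι

end Match

end RRule

/-! ## The rules of the recognition system as local moves -/

section BlankRule

variable {n a b c d : ℕ} {hL : n ≤ a} {hR : n ≤ c} {sL tL : Fin b → Fin a} {lL : Fin a → NLabel}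
  {pL : Fin a → Bool} {sR tR : Fin d → Fin c} {lR : Fin c → NLabel} {pR : Fin c → Bool}
  {G : RGraph NLabel ELabel}

/-- The maps `gV`, `gE` are the components of a match in `G` of a rule with blank interface on the
nodes below `n` and with the given left-hand side. -/
structure IsBlankMatch (n : ℕ) (sL tL : Fin b → Fin a) (lL : Fin a → NLabel) (pL : Fin a → Bool)
    (G : RGraph NLabel ELabel) (gV : Fin a → G.V) (gE : Fin b → G.E) : Prop where
  injV : Function.Injective gV
  injE : Function.Injective gE
  map_s : ∀ e, gV (sL e) = G.s (gE e)
  map_t : ∀ e, gV (tL e) = G.t (gE e)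
  map_l : ∀ i, G.l (gV i) = some (lL i)
  map_p : ∀ i, G.p (gV i) = some (pL i)
  dangling : ∀ i : Fin a, n ≤ i.1 → ∀ f, G.s f = gV i ∨ G.t f = gV i → ∃ j, gE j = f

/-- The match of a blank rule given by an `IsBlankMatch`. -/
def blankMatch {gV : Fin a → G.V} {gE : Fin b → G.E} (h : IsBlankMatch n sL tL lL pL G gV gE) :
    (blankRule n a b c d hL hR sL tL lL pL sR tR lR pR).Match G where
  g :=
    { onV := gV
      onE := gE
      map_s := h.map_s
      map_t := h.map_t
      map_m := fun _ => rfl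
      map_l := fun i _ => (h.map_l i).symm
      map_p := fun i _ => (h.map_p i).symm }
  inj := ⟨h.injV, h.injE⟩
  dangling := fun f hf i hi => not_or.1 fun h' =>
    hf (h.dangling i (not_lt.1 fun hlt => hi ⟨(⟨i.1, hlt⟩ : Fin n), rfl⟩) f h')

theorem isBlankMatch (M : (blankRule n a b c d hL hR sL tL lL pL sR tR lR pR).Match G) :
    IsBlankMatch n sL tL lL pL G M.g.onV M.g.onE where
  injV := M.inj.1
  injE := M.inj.2
  map_s := M.g.map_s
  map_t := M.g.map_t
  map_l i := (M.g.map_l i (Option.some_ne_none _)).symm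
  map_p i := (M.g.map_p i (Option.some_ne_none _)).symm
  dangling i hi f hf := by
    by_contra hfE
    refine not_or.2 (M.dangling f hfE i ?_) hf
    rintro ⟨k, rfl⟩
    exact absurd k.2 (not_lt.2 hi)

/-- Embeddings over the interface for blank rules, given by maps `ρ`, `ρE` on the indices of the
vertices and of the edges. -/
def blankEmbedding (ρ : Fin c → Fin a) (ρE : Fin d → Fin b) (hρ : Function.Injective ρ)
    (hρE : Function.Injective ρE) (hs : ∀ e, ρ (sR e) = sL (ρE e))
    (ht : ∀ e, ρ (tR e) = tL (ρE e)) (hK : ∀ i, ρ (Fin.castLE hR i) = Fin.castLE hL i) :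
    (blankRule n a b c d hL hR sL tL lL pL sR tR lR pR).Embedding where
  onV := ρ
  onE := ρE
  injV := hρ
  injE := hρE
  map_s := hs
  map_t := ht
  map_m _ := rfl
  onV_right := hK
  onE_right k := Fin.elim0 k

end BlankRule

namespace FBT

open NLabel RGraph

variable {G H : RGraph NLabel ELabel} {v : G.V}

open Classical in
/-- All vertices are labelled, and `v`, a square, is the only root. -/
structure RootedAt (G : RGraph NLabel ELabel) (v : G.V) : Prop where
  l_ne_none : ∀ w, G.l w ≠ none
  l_root : G.l v = some box
  p_eq : ∀ w, G.p w = some (decide (w = v))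

theorem RootedAt.isTLRG (hv : RootedAt G v) : G.IsTLRG :=
  ⟨hv.l_ne_none, fun w => by simp only [hv.p_eq, ne_eq, reduceCtorEq, not_false_eq_true]⟩

theorem RootedAt.p_eq_true_iff (hv : RootedAt G v) {w : G.V} : G.p w = some true ↔ w = v := by
  simp only [hv.p_eq, Option.some.injEq, decide_eq_true_eq]

/-- The shape that all steps of the system have on a graph with a single root: delete `delV` and
`delE`, give the label `label` to the vertex `site`, and make `root` the only root. -/
@[ext]
structure Move (G : RGraph NLabel ELabel) where
  delV : Set G.V
  delE : Set G.E
  root : G.V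
  site : G.V
  label : NLabel

open Classical in
/-- The edit performed by a move. -/
noncomputable def Move.edit (X : Move G) : G.Edit where
  delV := X.delV
  delE := X.delE
  l := Function.update G.l X.site (some X.label)
  p w := some (decide (w = X.root))

theorem Move.isTLRG_of_reduct {X : Move G} (R : X.edit.Reduct H) (hl : ∀ w, G.l w ≠ none) :
    H.IsTLRG := by
  classical
  refine ⟨fun w => ?_, fun w => ?_⟩
  · rw [R.map_l]
    change Function.update G.l X.site (some X.label) (R.onV w) ≠ none
    by_cases hw : R.onV w = X.site
    · rw [hw, Function.update_self]
      exact Option.some_ne_none _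
    · rw [Function.update_of_ne hw]
      exact hl _
  · rw [R.map_p]
    exact Option.some_ne_none _

variable {r : RRule NLabel ELabel} {ι : r.Embedding} {i j : r.L.V} {α : NLabel}

/-- A rule whose right-hand side embeds into its left-hand side acts as a move: it shifts the root
to `i` and gives the label `α` to `j`. -/
structure IsMoveRule (ι : r.Embedding) (i j : r.L.V) (α : NLabel) : Prop where
  root_mem : i ∈ Set.range ι.onV
  site_mem : j ∈ Set.range ι.onV
  exists_root : ∃ x, r.L.p (ι.onV x) = some true
  l_site : ∀ x, ι.onV x = j → r.R.l x = some α
  l_of_ne : ∀ x, ι.onV x ≠ j → r.R.l x = r.L.l (ι.onV x)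
  p_root : ∀ x, ι.onV x = i → r.R.p x = some true
  p_of_ne : ∀ x, ι.onV x ≠ i → r.R.p x = some false

/-- The move at a match that shifts the root to the image of `i` and labels the image of `j` with
`α`. -/
def matchMove (M : r.Match G) (ι : r.Embedding) (i j : r.L.V) (α : NLabel) : Move G where
  delV := M.g.onV '' (Set.range ι.onV)ᶜ
  delE := M.g.onE '' (Set.range ι.onE)ᶜ
  root := M.g.onV i
  site := M.g.onV j
  label := α

open Classical in
theorem IsMoveRule.extend_l (h : IsMoveRule ι i j α) (M : r.Match G) :
    Function.extend (M.g.onV ∘ ι.onV) r.R.l G.l = Function.update G.l (M.g.onV j) (some α) := by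
  ext1 w
  by_cases hw : ∃ x, (M.g.onV ∘ ι.onV) x = w
  · obtain ⟨x, rfl⟩ := hw
    rw [(M.inj.1.comp ι.injV).extend_apply]
    by_cases hx : ι.onV x = j
    · rw [h.l_site x hx, Function.comp_apply, hx, Function.update_self]
    · rw [h.l_of_ne x hx, Function.comp_apply, Function.update_of_ne (M.inj.1.ne hx),
        ← M.g.map_l _ (r.L_total.1 _)]
  · obtain ⟨y, rfl⟩ := h.site_mem
    have hwy : w ≠ M.g.onV (ι.onV y) := fun hy => hw ⟨y, hy.symm⟩
    rw [Function.extend_apply' _ _ _ hw, Function.update_of_ne hwy]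

open Classical in
theorem IsMoveRule.extend_p (h : IsMoveRule ι i j α) (hv : RootedAt G v) (M : r.Match G) :
    Function.extend (M.g.onV ∘ ι.onV) r.R.p G.p = fun w => some (decide (w = M.g.onV i)) := by
  ext1 w
  by_cases hw : ∃ x, (M.g.onV ∘ ι.onV) x = w
  · obtain ⟨x, rfl⟩ := hw
    rw [(M.inj.1.comp ι.injV).extend_apply]
    by_cases hx : ι.onV x = i
    · simp only [h.p_root x hx, Function.comp_apply, hx, decide_true]
    · simp only [h.p_of_ne x hx, Function.comp_apply, M.inj.1.eq_iff, hx, decide_false]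
  · obtain ⟨y, rfl⟩ := h.root_mem
    obtain ⟨x, hx⟩ := h.exists_root
    have hxv : M.g.onV (ι.onV x) = v := by
      rw [← hv.p_eq_true_iff, ← M.g.map_p _ (r.L_total.2 _), hx]
    rw [Function.extend_apply' _ _ _ hw, hv.p_eq, decide_eq_false, decide_eq_false]
    · exact fun hy => hw ⟨y, hy.symm⟩
    · exact fun hwv => hw ⟨x, hxv.trans hwv.symm⟩

theorem IsMoveRule.edit_eq (h : IsMoveRule ι i j α) (hv : RootedAt G v) (M : r.Match G) :
    M.edit ι = (matchMove M ι i j α).edit := by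
  rw [RRule.Match.edit, h.extend_l M, h.extend_p hv M]
  rfl

/-- The vertex `v` has exactly two outgoing edges `e₁`, `e₂`; their targets are distinct square
leaves without further incoming edges. -/
structure Cherry (G : RGraph NLabel ELabel) (v : G.V) (e₁ e₂ : G.E) : Prop where
  s₁ : G.s e₁ = v
  s₂ : G.s e₂ = v
  t_ne : G.t e₁ ≠ G.t e₂
  l₁ : G.l (G.t e₁) = some box
  l₂ : G.l (G.t e₂) = some box
  out : ∀ f, G.s f = v → f = e₁ ∨ f = e₂
  leaf₁ : ∀ f, G.s f ≠ G.t e₁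
  leaf₂ : ∀ f, G.s f ≠ G.t e₂
  in₁ : ∀ f, G.t f = G.t e₁ → f = e₁
  in₂ : ∀ f, G.t f = G.t e₂ → f = e₂

/-- The edges `e`, `e'` form a directed path of three distinct vertices from `v`, of which the last
two are squares. -/
structure SquarePath (G : RGraph NLabel ELabel) (v : G.V) (e e' : G.E) : Prop where
  s_eq : G.s e = v
  s_eq' : G.s e' = G.t e
  t_ne : G.t e ≠ v
  t_ne' : G.t e' ≠ v
  t_ne_t : G.t e' ≠ G.t e
  l_child : G.l (G.t e) = some box
  l_grandchild : G.l (G.t e') = some box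

/-- The moves that the rules allow on a graph with the single root `v`. -/
inductive Redex (G : RGraph NLabel ELabel) (v : G.V) : Move G → Prop
  | top {e₁ e₂ : G.E} (cherry : Cherry G v e₁ e₂) (no_in : ∀ f, G.t f ≠ v) :
      Redex G v ⟨{G.t e₁, G.t e₂}, {e₁, e₂}, v, v, box⟩
  | prune {e e₁ e₂ : G.E} (cherry : Cherry G v e₁ e₂) (t_eq : G.t e = v)
      (in_unique : ∀ f, G.t f = v → f = e) :
      Redex G v ⟨{G.t e₁, G.t e₂}, {e₁, e₂}, G.s e, G.s e, box⟩
  | descend {e e' : G.E} (path : SquarePath G v e e') : Redex G v ⟨∅, ∅, G.t e, v, tri⟩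
  | ascend {e : G.E} (t_eq : G.t e = v) (l_parent : G.l (G.s e) = some box)
      (no_out : ∀ f, G.s f ≠ v) (in_unique : ∀ f, G.t f = v → f = e) :
      Redex G v ⟨∅, ∅, G.s e, G.s e, box⟩

section BlankRule

variable {n a b c d : ℕ} {hL : n ≤ a} {hR : n ≤ c} {sL tL : Fin b → Fin a} {lL : Fin a → NLabel}
  {pL : Fin a → Bool} {sR tR : Fin d → Fin c} {lR : Fin c → NLabel} {pR : Fin c → Bool}

theorem isMoveRule_blankEmbedding {ρ : Fin c → Fin a} {ρE : Fin d → Fin b}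
    {hρ : Function.Injective ρ} {hρE : Function.Injective ρE} {hs : ∀ e, ρ (sR e) = sL (ρE e)}
    {ht : ∀ e, ρ (tR e) = tL (ρE e)} {hK : ∀ k, ρ (Fin.castLE hR k) = Fin.castLE hL k}
    {i j : Fin a} {α : NLabel} (hi : ∃ x, ρ x = i) (hj : ∃ x, ρ x = j)
    (hroot : ∃ x, pL (ρ x) = true) (hl : ∀ x, lR x = if ρ x = j then α else lL (ρ x))
    (hp : ∀ x, pR x = decide (ρ x = i)) :
    IsMoveRule (r := blankRule n a b c d hL hR sL tL lL pL sR tR lR pR)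
      (blankEmbedding ρ ρE hρ hρE hs ht hK) i j α where
  root_mem := hi
  site_mem := hj
  exists_root := hroot.imp fun _ h => congrArg some h
  l_site x hx := congrArg some ((hl x).trans (if_pos hx))
  l_of_ne x hx := congrArg some ((hl x).trans (if_neg hx))
  p_root x hx := congrArg some ((hp x).trans (decide_eq_true hx))
  p_of_ne x hx := congrArg some ((hp x).trans (decide_eq_false hx))

end BlankRule

/-- The embedding for `r0`: the surviving root is the old root. -/
def embedding₀ : r0.Embedding :=
  blankEmbedding ![0] ![] (by decide) (by decide) (by decide) (by decide) (by decide)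

/-- The embedding for `prune c`: the surviving nodes are the numbered node and the old root. -/
def embeddingPrune (c : NLabel) : (prune c).Embedding :=
  blankEmbedding ![0, 1] ![0] (by decide) (by decide) (by decide) (by decide) (by decide)

/-- The embedding for `r3`, which deletes nothing. -/
def embedding₃ : r3.Embedding :=
  blankEmbedding id id (by decide) (by decide) (by decide) (by decide) (by decide)

/-- The embedding for `r4`, which deletes nothing. -/
def embedding₄ : r4.Embedding :=
  blankEmbedding id id (by decide) (by decide) (by decide) (by decide) (by decide)

theorem isMoveRule_r0 : IsMoveRule embedding₀ (0 : Fin 3) (0 : Fin 3) box :=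
  isMoveRule_blankEmbedding (by decide) (by decide) (by decide) (by decide) (by decide)

theorem isMoveRule_prune (c : NLabel) :
    IsMoveRule (embeddingPrune c) (0 : Fin 4) (0 : Fin 4) box :=
  isMoveRule_blankEmbedding (by decide) (by decide) (by decide) (by cases c <;> decide) (by decide)

theorem isMoveRule_r3 : IsMoveRule embedding₃ (1 : Fin 3) (0 : Fin 3) tri :=
  isMoveRule_blankEmbedding (by decide) (by decide) (by decide) (by decide) (by decide)

theorem isMoveRule_r4 : IsMoveRule embedding₄ (0 : Fin 2) (0 : Fin 2) box :=
  isMoveRule_blankEmbedding (by decide) (by decide) (by decide) (by decide) (by decide)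

theorem Cherry.ne_root₁ {e₁ e₂ : G.E} (h : Cherry G v e₁ e₂) : G.t e₁ ≠ v := fun he =>
  h.leaf₁ e₁ (h.s₁.trans he.symm)

theorem Cherry.ne_root₂ {e₁ e₂ : G.E} (h : Cherry G v e₁ e₂) : G.t e₂ ≠ v := fun he =>
  h.leaf₂ e₂ (h.s₂.trans he.symm)

section ImageComplRange

variable {α : Type*}

theorem image_compl_range_id {β : Type*} (g : α → β) : g '' (Set.range id)ᶜ = ∅ := by
  rw [Set.range_id, Set.compl_univ, Set.image_empty]

theorem image_compl_range_empty (g : Fin 2 → α) : g '' (Set.range ![])ᶜ = {g 0, g 1} := by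
  rw [← Set.image_pair]
  congr 1
  ext i
  fin_cases i <;> simp

theorem image_compl_range_zero (g : Fin 3 → α) : g '' (Set.range ![0])ᶜ = {g 1, g 2} := by
  rw [← Set.image_pair]
  congr 1
  ext i
  fin_cases i <;> simp

theorem image_compl_range_zero_one (g : Fin 4 → α) :
    g '' (Set.range ![0, 1])ᶜ = {g 2, g 3} := by
  rw [← Set.image_pair]
  congr 1
  ext i
  fin_cases i <;> simp

end ImageComplRange

theorem redex_of_isBlankMatch_r0 (hv : RootedAt G v) {gV : Fin 3 → G.V} {gE : Fin 2 → G.E}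
    (h : IsBlankMatch 0 ![0, 0] ![1, 2] ![box, box, box] ![true, false, false] G gV gE) :
    Redex G v ⟨gV '' (Set.range ![0])ᶜ, gE '' (Set.range ![])ᶜ, gV 0, gV 0, box⟩ := by
  obtain rfl : gV 0 = v := hv.p_eq_true_iff.1 (h.map_p 0)
  rw [image_compl_range_zero, image_compl_range_empty]
  obtain ⟨hV, hE, hs, ht, hl, -, hd⟩ := h
  simp only [Function.Injective, Fin.forall_fin_succ, Fin.exists_fin_succ,
    IsEmpty.forall_iff, IsEmpty.exists_iff, Matrix.cons_val, Fin.isValue, Fin.reduceSucc]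
    at hs ht hl hd hV hE
  rw [ht.1, ht.2.1]
  refine .top ?_ ?_
  · constructor <;> grind
  · grind

theorem Cherry.isBlankMatch_r0 (hv : RootedAt G v) {e₁ e₂ : G.E} (h : Cherry G v e₁ e₂)
    (no_in : ∀ f, G.t f ≠ v) :
    IsBlankMatch 0 ![0, 0] ![1, 2] ![box, box, box] ![true, false, false] G
      ![v, G.t e₁, G.t e₂] ![e₁, e₂] := by
  obtain ⟨s₁, s₂, t_ne, l₁, l₂, out, leaf₁, leaf₂, in₁, in₂⟩ := h
  constructor
  all_goals simp only [Function.Injective, Fin.forall_fin_succ, Fin.exists_fin_succ,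
    IsEmpty.forall_iff, IsEmpty.exists_iff, Matrix.cons_val, Fin.isValue, Fin.reduceSucc]
  all_goals grind [hv.p_eq, hv.l_root]

theorem redex_of_isBlankMatch_prune (hv : RootedAt G v) {c : NLabel} {gV : Fin 4 → G.V}
    {gE : Fin 3 → G.E}
    (h : IsBlankMatch 1 ![0, 1, 1] ![1, 2, 3] ![c, box, box, box] ![false, true, false, false] G
      gV gE) :
    Redex G v ⟨gV '' (Set.range ![0, 1])ᶜ, gE '' (Set.range ![0])ᶜ, gV 0, gV 0, box⟩ := by
  obtain rfl : gV 1 = v := hv.p_eq_true_iff.1 (h.map_p 1)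
  rw [image_compl_range_zero_one, image_compl_range_zero]
  obtain ⟨hV, hE, hs, ht, hl, -, hd⟩ := h
  simp only [Function.Injective, Fin.forall_fin_succ, Fin.exists_fin_succ,
    IsEmpty.forall_iff, IsEmpty.exists_iff, Matrix.cons_val, Fin.isValue, Fin.reduceSucc]
    at hs ht hl hd hV hE
  rw [ht.2.1, ht.2.2.1, hs.1]
  refine .prune ?_ ?_ ?_
  · constructor <;> grind
  all_goals grind

theorem redex_of_isBlankMatch_r3 (hv : RootedAt G v) {gV : Fin 3 → G.V} {gE : Fin 2 → G.E}
    (h : IsBlankMatch 3 ![0, 1] ![1, 2] ![box, box, box] ![true, false, false] G gV gE) :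
    Redex G v ⟨gV '' (Set.range id)ᶜ, gE '' (Set.range id)ᶜ, gV 1, gV 0, tri⟩ := by
  obtain rfl : gV 0 = v := hv.p_eq_true_iff.1 (h.map_p 0)
  rw [image_compl_range_id, image_compl_range_id]
  obtain ⟨hV, -, hs, ht, hl, -, -⟩ := h
  simp only [Function.Injective, Fin.forall_fin_succ, IsEmpty.forall_iff,
    Matrix.cons_val, Fin.isValue, Fin.reduceSucc]
    at hs ht hl hV
  rw [ht.1]
  refine .descend (e' := gE 1) ?_
  constructor <;> grind

theorem redex_of_isBlankMatch_r4 (hv : RootedAt G v) {gV : Fin 2 → G.V} {gE : Fin 1 → G.E}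
    (h : IsBlankMatch 1 ![0] ![1] ![box, box] ![false, true] G gV gE) :
    Redex G v ⟨gV '' (Set.range id)ᶜ, gE '' (Set.range id)ᶜ, gV 0, gV 0, box⟩ := by
  obtain rfl : gV 1 = v := hv.p_eq_true_iff.1 (h.map_p 1)
  rw [image_compl_range_id, image_compl_range_id]
  obtain ⟨hV, hE, hs, ht, hl, -, hd⟩ := h
  simp only [Function.Injective, Fin.forall_fin_succ, Fin.exists_fin_succ,
    IsEmpty.forall_iff, IsEmpty.exists_iff, Matrix.cons_val, Fin.isValue, Fin.reduceSucc]
    at hs ht hl hd hV hE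
  rw [hs.1]
  exact .ascend (by grind) (by grind) (by grind) (by grind)

theorem Cherry.isBlankMatch_prune {c : NLabel} (hv : RootedAt G v) {e e₁ e₂ : G.E}
    (h : Cherry G v e₁ e₂) (t_eq : G.t e = v) (in_unique : ∀ f, G.t f = v → f = e)
    (hc : G.l (G.s e) = some c) :
    IsBlankMatch 1 ![0, 1, 1] ![1, 2, 3] ![c, box, box, box] ![false, true, false, false] G
      ![G.s e, v, G.t e₁, G.t e₂] ![e, e₁, e₂] := by
  have s_ne : G.s e ≠ v := fun he => (h.out e he).elim (fun h₁ => h.ne_root₁ (h₁ ▸ t_eq))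
    fun h₂ => h.ne_root₂ (h₂ ▸ t_eq)
  obtain ⟨s₁, s₂, t_ne, l₁, l₂, out, leaf₁, leaf₂, in₁, in₂⟩ := h
  constructor
  all_goals simp only [Function.Injective, Fin.forall_fin_succ, Fin.exists_fin_succ,
    IsEmpty.forall_iff, IsEmpty.exists_iff, Matrix.cons_val, Fin.isValue, Fin.reduceSucc]
  all_goals grind [hv.p_eq, hv.l_root]

theorem SquarePath.isBlankMatch_r3 (hv : RootedAt G v) {e e' : G.E} (h : SquarePath G v e e') :
    IsBlankMatch 3 ![0, 1] ![1, 2] ![box, box, box] ![true, false, false] G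
      ![v, G.t e, G.t e'] ![e, e'] := by
  obtain ⟨s_eq, s_eq', t_ne, t_ne', t_ne_t, l_child, l_grandchild⟩ := h
  constructor
  all_goals simp only [Function.Injective, Fin.forall_fin_succ, Fin.exists_fin_succ,
    IsEmpty.forall_iff, IsEmpty.exists_iff, Matrix.cons_val, Fin.isValue, Fin.reduceSucc]
  all_goals grind [hv.p_eq, hv.l_root]

theorem isBlankMatch_r4 (hv : RootedAt G v) {e : G.E} (t_eq : G.t e = v)
    (l_parent : G.l (G.s e) = some box) (no_out : ∀ f, G.s f ≠ v)
    (in_unique : ∀ f, G.t f = v → f = e) :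
    IsBlankMatch 1 ![0] ![1] ![box, box] ![false, true] G ![G.s e, v] ![e] := by
  constructor
  all_goals simp only [Function.Injective, Fin.forall_fin_succ, Fin.exists_fin_succ,
    IsEmpty.forall_iff, IsEmpty.exists_iff, Matrix.cons_val, Fin.isValue, Fin.reduceSucc]
  all_goals grind [hv.p_eq, hv.l_root]

theorem exists_redex_of_match (hv : RootedAt G v) {r : RRule NLabel ELabel} (hr : r ∈ rules)
    (M : r.Match G) :
    ∃ (ι : r.Embedding) (X : Move G), Redex G v X ∧ M.edit ι = X.edit := by
  rcases hr with rfl | rfl | rfl | rfl | rfl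
  · exact ⟨_, _, redex_of_isBlankMatch_r0 hv (isBlankMatch M), isMoveRule_r0.edit_eq hv M⟩
  · exact ⟨_, _, redex_of_isBlankMatch_prune hv (isBlankMatch M),
      (isMoveRule_prune box).edit_eq hv M⟩
  · exact ⟨_, _, redex_of_isBlankMatch_prune hv (isBlankMatch M),
      (isMoveRule_prune tri).edit_eq hv M⟩
  · exact ⟨_, _, redex_of_isBlankMatch_r3 hv (isBlankMatch M), isMoveRule_r3.edit_eq hv M⟩
  · exact ⟨_, _, redex_of_isBlankMatch_r4 hv (isBlankMatch M), isMoveRule_r4.edit_eq hv M⟩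

theorem prune_mem_rules (c : NLabel) : prune c ∈ rules := by
  cases c
  · exact .inr (.inl rfl)
  · exact .inr (.inr (.inl rfl))

theorem exists_match_of_redex (hv : RootedAt G v) {X : Move G} (hX : Redex G v X) :
    ∃ r ∈ rules, ∃ (ι : r.Embedding) (M : r.Match G), M.edit ι = X.edit := by
  rcases hX with @⟨e₁, e₂, h, no_in⟩ | @⟨e, e₁, e₂, h, t_eq, in_unique⟩ |
    ⟨path⟩ | ⟨t_eq, l_parent, no_out, in_unique⟩
  · refine ⟨r0, .inl rfl, embedding₀, blankMatch (h.isBlankMatch_r0 hv no_in),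
      (isMoveRule_r0.edit_eq hv _).trans (congrArg Move.edit ?_)⟩
    exact Move.ext (image_compl_range_zero ![v, G.t e₁, G.t e₂])
      (image_compl_range_empty ![e₁, e₂]) rfl rfl rfl
  · obtain ⟨c, hc⟩ := Option.ne_none_iff_exists'.1 (hv.l_ne_none (G.s e))
    refine ⟨prune c, prune_mem_rules c, embeddingPrune c,
      blankMatch (h.isBlankMatch_prune hv t_eq in_unique hc),
      ((isMoveRule_prune c).edit_eq hv _).trans (congrArg Move.edit ?_)⟩
    exact Move.ext (image_compl_range_zero_one ![G.s e, v, G.t e₁, G.t e₂])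
      (image_compl_range_zero ![e, e₁, e₂]) rfl rfl rfl
  · refine ⟨r3, .inr (.inr (.inr (.inl rfl))), embedding₃,
      blankMatch (path.isBlankMatch_r3 hv),
      (isMoveRule_r3.edit_eq hv _).trans (congrArg Move.edit ?_)⟩
    exact Move.ext (image_compl_range_id _) (image_compl_range_id _) rfl rfl rfl
  · refine ⟨r4, .inr (.inr (.inr (.inr rfl))), embedding₄,
      blankMatch (isBlankMatch_r4 hv t_eq l_parent no_out in_unique),
      (isMoveRule_r4.edit_eq hv _).trans (congrArg Move.edit ?_)⟩
    exact Move.ext (image_compl_range_id _) (image_compl_range_id _) rfl rfl rfl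

theorem RootedAt.directlyDerives_iff (hv : RootedAt G v) :
    DirectlyDerives rules G H ↔ ∃ X, Redex G v X ∧ Nonempty (X.edit.Reduct H) := by
  constructor
  · rintro ⟨-, r, hr, M, hM⟩
    obtain ⟨ι, X, hX, hι⟩ := exists_redex_of_match hv hr M
    have R : X.edit.Reduct M.result := hι ▸ M.resultReduct ι
    obtain ⟨f⟩ := hM.exists_iso (Move.isTLRG_of_reduct R hv.l_ne_none)
    exact ⟨X, hX, ⟨R.transIso f⟩⟩
  · rintro ⟨X, hX, ⟨R⟩⟩
    obtain ⟨r, hr, ι, M, hι⟩ := exists_match_of_redex hv hX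
    exact ⟨hv.isTLRG, r, hr, M, ((hι ▸ M.resultReduct ι : X.edit.Reduct M.result).iso R).isomorphic⟩

theorem RootedAt.inNormalForm_iff (hv : RootedAt G v) :
    InNormalForm rules G ↔ ∀ X, ¬ Redex G v X := by
  refine ⟨fun h X hX => ?_, fun h H hH => ?_⟩
  · obtain ⟨r, hr, ι, M, -⟩ := exists_match_of_redex hv hX
    exact h _ ⟨hv.isTLRG, r, hr, M, (Iso.refl _).isomorphic⟩
  · obtain ⟨X, hX, -⟩ := hv.directlyDerives_iff.1 hH
    exact h X hX

end FBT

/-! ## Directed paths and arborescences -/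

namespace RGraph

open Relation

variable {LV LE : Type} {G H : RGraph LV LE} {r u v w : G.V}

/-- There is an edge from `u` to `w`. -/
def Step (G : RGraph LV LE) (u w : G.V) : Prop := ∃ e, G.s e = u ∧ G.t e = w

theorem step (e : G.E) : G.Step (G.s e) (G.t e) := ⟨e, rfl, rfl⟩

theorem UWalk.append {es fs : List G.E} (h : G.UWalk u v es) (h' : G.UWalk v w fs) :
    G.UWalk u w (es ++ fs) := by
  induction h with
  | nil v => exact h'
  | fwd e w es _ ih => exact .fwd e _ _ (ih h')
  | bwd e w es _ ih => exact .bwd e _ _ (ih h')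

theorem UWalk.reverse {es : List G.E} (h : G.UWalk u v es) : G.UWalk v u es.reverse := by
  induction h with
  | nil v => exact .nil v
  | fwd e w es _ ih =>
    rw [List.reverse_cons]
    exact ih.append (.bwd e _ _ (.nil _))
  | bwd e w es _ ih =>
    rw [List.reverse_cons]
    exact ih.append (.fwd e _ _ (.nil _))

theorem exists_uWalk_of_reflTransGen (h : ReflTransGen G.Step u w) : ∃ es, G.UWalk u w es := by
  induction h with
  | refl => exact ⟨[], .nil u⟩
  | tail _ h ih =>
    obtain ⟨es, hes⟩ := ih
    obtain ⟨e, rfl, rfl⟩ := h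
    exact ⟨_, hes.append (.fwd e _ _ (.nil _))⟩

/-- If every vertex has at most one incoming edge, then a trail that does not start against an edge
cannot turn around later. -/
theorem UWalk.eq_nil_or_transGen (hin : Function.Injective G.t) {es : List G.E}
    (h : G.UWalk u w es) (hn : es.Nodup) (hh : ∀ e ∈ es.head?, G.t e ≠ u) :
    u = w ∧ es = [] ∨ TransGen G.Step u w := by
  induction h with
  | nil v => exact .inl ⟨rfl, rfl⟩
  | fwd e w es _ ih =>
    rw [List.nodup_cons] at hn
    have hh' : ∀ f ∈ es.head?, G.t f ≠ G.t e := fun f hf ht =>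
      hn.1 (hin ht ▸ List.mem_of_mem_head? hf)
    rcases ih hn.2 hh' with ⟨rfl, -⟩ | h
    · exact .inr (.single (step e))
    · exact .inr (h.head (step e))
  | bwd e w es => exact absurd rfl (hh e rfl)

theorem UWalk.eq_of_nil (h : G.UWalk u w []) : u = w := by
  cases h
  rfl

theorem UWalk.transGen_of_singleton {e : G.E} (h : G.UWalk v v [e]) : TransGen G.Step v v := by
  refine .single ⟨e, ?_⟩
  cases h with
  | fwd _ _ _ h => exact ⟨rfl, h.eq_of_nil⟩
  | bwd _ _ _ h => exact ⟨h.eq_of_nil, rfl⟩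

theorem not_hasUCycle (hin : Function.Injective G.t) (hG : ∀ v, ¬ TransGen G.Step v v) :
    ¬ G.HasUCycle := by
  rintro ⟨v, es, hne, hn, hw⟩
  have start_mem : ∀ {fs}, fs ≠ [] → fs.Nodup → G.UWalk v v fs → ∃ e ∈ fs.head?, G.t e = v := by
    intro fs hne hn hw
    by_contra! hc
    rcases hw.eq_nil_or_transGen hin hn hc with ⟨-, h⟩ | h
    · exact hne h
    · exact hG v h
  obtain ⟨e, he, hte⟩ := start_mem hne hn hw
  obtain ⟨f, hf, htf⟩ := start_mem (mt List.reverse_eq_nil_iff.1 hne) (List.nodup_reverse.2 hn)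
    hw.reverse
  obtain rfl := hin (hte.trans htf.symm)
  obtain ⟨fs, rfl⟩ := List.head?_eq_some_iff.1 he
  cases fs with
  | nil => exact hG v hw.transGen_of_singleton
  | cons f fs =>
    rw [List.head?_reverse, List.getLast?_cons_cons] at hf
    exact (List.nodup_cons.1 hn).1 (List.mem_of_mem_getLast? hf)

theorem exists_nodup_isChain {α : Type*} {R : α → α → Prop} {a b : α} (h : ReflTransGen R a b) :
    ∃ l, (a :: l).Nodup ∧ (a :: l).IsChain R ∧ (a :: l).getLast (List.cons_ne_nil a l) = b := by
  induction h using ReflTransGen.head_induction_on with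
  | refl => exact ⟨[], List.nodup_singleton b, .singleton b, rfl⟩
  | @head a c hac _ ih =>
    obtain ⟨l, hn, hl, hb⟩ := ih
    by_cases ha : a ∈ c :: l
    · obtain ⟨l₁, l₂, hl'⟩ := List.append_of_mem ha
      simp only [hl'] at hn hl hb
      exact ⟨l₂, hn.of_append_right, hl.right_of_append,
        (List.getLast_append_of_ne_nil _ _).symm.trans hb⟩
    · exact ⟨c :: l, List.nodup_cons.2 ⟨ha, hn⟩, hl.cons_cons hac, hb⟩

theorem uWalk_of_isChain {e : G.E} {es : List G.E}
    (h : (e :: es).IsChain fun e f => G.t e = G.s f) :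
    G.UWalk (G.s e) (G.t ((e :: es).getLast (List.cons_ne_nil e es))) (e :: es) := by
  induction es generalizing e with
  | nil => exact .fwd e _ _ (.nil _)
  | cons f es ih =>
    rw [List.isChain_cons_cons] at h
    exact .fwd e _ _ (h.1 ▸ ih h.2)

theorem exists_reflTransGen_edges (h : TransGen G.Step u w) :
    ∃ e f, G.s e = u ∧ G.t f = w ∧ ReflTransGen (fun e f => G.t e = G.s f) e f := by
  induction h with
  | single h =>
    obtain ⟨e, he⟩ := h
    exact ⟨e, e, he.1, he.2, .refl⟩
  | tail _ h ih =>
    obtain ⟨e, f, he, hf, hef⟩ := ih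
    obtain ⟨g, hg⟩ := h
    exact ⟨e, g, he, hg.2, hef.tail (hf.trans hg.1.symm)⟩

theorem not_transGen_step_self (hG : ¬ G.HasUCycle) (v : G.V) : ¬ TransGen G.Step v v := by
  intro h
  obtain ⟨e, f, rfl, hf, hef⟩ := exists_reflTransGen_edges h
  obtain ⟨es, hn, hes, hlast⟩ := exists_nodup_isChain hef
  have hw := uWalk_of_isChain hes
  rw [hlast, hf] at hw
  exact hG ⟨_, _, List.cons_ne_nil e es, hn, hw⟩

theorem exists_forall_t_ne [Nonempty G.V] (hG : ∀ v, ¬ TransGen G.Step v v) :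
    ∃ r, ∀ e, G.t e ≠ r := by
  have := G.finV
  have : Std.Irrefl (TransGen G.Step) := ⟨hG⟩
  obtain ⟨r, -, hr⟩ := (Finite.wellFounded_of_trans_of_irrefl (TransGen G.Step)).has_min Set.univ
    Set.univ_nonempty
  exact ⟨r, fun e he => hr _ trivial (.single ⟨e, rfl, he⟩)⟩

/-- `r` has no incoming edge, the other vertices have at most one, and all vertices can be reached
from `r` by directed paths. -/
structure IsArborescence (G : RGraph LV LE) (r : G.V) : Prop where
  t_ne : ∀ e, G.t e ≠ r
  t_inj : Function.Injective G.t
  reachable : ∀ w, ReflTransGen G.Step r w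

namespace IsArborescence

theorem not_transGen_self (hG : G.IsArborescence r) (v : G.V) : ¬ TransGen G.Step v v := by
  induction hG.reachable v with
  | refl =>
    intro h
    obtain ⟨w, -, e, -, he⟩ := TransGen.tail'_iff.1 h
    exact hG.t_ne e he
  | tail _ huv ih =>
    obtain ⟨e, rfl, rfl⟩ := huv
    intro h
    obtain ⟨w, hw, f, rfl, hf⟩ := TransGen.tail'_iff.1 h
    obtain rfl := hG.t_inj hf
    exact ih (.head' (step f) hw)

theorem connected (hG : G.IsArborescence r) : G.Connected := fun u w => by
  obtain ⟨es, hes⟩ := exists_uWalk_of_reflTransGen (hG.reachable u)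
  obtain ⟨fs, hfs⟩ := exists_uWalk_of_reflTransGen (hG.reachable w)
  exact ⟨_, hes.reverse.append hfs⟩

end IsArborescence

theorem indeg_le_one_iff : (∀ v, G.indeg v ≤ 1) ↔ Function.Injective G.t := by
  have := G.finE
  simp only [indeg, Finite.card_le_one_iff_subsingleton]
  exact ⟨fun h e e' he => congrArg Subtype.val ((h (G.t e')).elim ⟨e, he⟩ ⟨e', rfl⟩),
    fun h v => ⟨fun e e' => Subtype.ext (h (e.2.trans e'.2.symm))⟩⟩

theorem reflTransGen_of_uWalk (hin : Function.Injective G.t) (hr : ∀ e, G.t e ≠ r) {es : List G.E}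
    (h : G.UWalk u w es) (hu : ReflTransGen G.Step r u) : ReflTransGen G.Step r w := by
  induction h with
  | nil => exact hu
  | fwd e _ _ _ ih => exact ih (hu.tail (step e))
  | bwd e _ _ _ ih =>
    rcases hu.cases_tail with he | ⟨v, hv, f, rfl, hf⟩
    · exact absurd he (hr e)
    · exact ih (hin hf ▸ hv)

theorem isTree_iff : G.IsTree ↔ ∃ r, G.IsArborescence r := by
  rw [IsTree, indeg_le_one_iff]
  constructor
  · rintro ⟨hne, hconn, hcycle, hin⟩
    obtain ⟨r, hr⟩ := exists_forall_t_ne (not_transGen_step_self hcycle)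
    refine ⟨r, hr, hin, fun w => ?_⟩
    obtain ⟨es, hes⟩ := hconn r w
    exact reflTransGen_of_uWalk hin hr hes .refl
  · rintro ⟨r, hr⟩
    exact ⟨⟨r⟩, hr.connected, not_hasUCycle hr.t_inj hr.not_transGen_self, hr.t_inj⟩

theorem ncard_children (hin : Function.Injective G.t) (v : G.V) :
    (G.children v).ncard = G.outdeg v := by
  change (G.t '' {e | G.s e = v}).ncard = _
  rw [Set.ncard_image_of_injective _ hin]
  rfl

theorem isFullBinaryTree_iff : G.IsFullBinaryTree ↔
    (∃ r, G.IsArborescence r) ∧ ∀ v, (G.children v).ncard = 0 ∨ (G.children v).ncard = 2 := by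
  rw [IsFullBinaryTree, IsBinaryTree, and_assoc, isTree_iff]
  refine and_congr_right fun ⟨r, hr⟩ => and_iff_right_of_imp fun h v => ?_
  rw [← ncard_children hr.t_inj]
  rcases h v with h | h <;> omega

end RGraph

/-! ## Removing leaves -/

namespace RGraph

open Relation

variable {LV LE : Type} {G H : RGraph LV LE}

/-- The edit deletes vertices without outgoing edges and with exactly one incoming edge, and no
edges but those leading to these vertices. -/
structure Edit.RemovesLeaves (X : G.Edit) : Prop where
  s_notMem : ∀ e, G.s e ∉ X.delV
  t_mem_iff : ∀ e, G.t e ∈ X.delV ↔ e ∈ X.delE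
  t_injOn : Set.InjOn G.t X.delE
  exists_t_eq : ∀ w ∈ X.delV, ∃ e, G.t e = w

theorem Edit.removesLeaves_of_eq_empty {X : G.Edit} (hV : X.delV = ∅) (hE : X.delE = ∅) :
    X.RemovesLeaves := by
  constructor <;> simp [hV, hE]

theorem Edit.Reduct.ncard_children {X : G.Edit} (R : X.Reduct H) (x : H.V) :
    (H.children x).ncard = (G.t '' {e | e ∉ X.delE ∧ G.s e = R.onV x}).ncard := by
  rw [← Set.ncard_image_of_injective _ R.injV]
  congr 1
  ext w
  constructor
  · rintro ⟨_, ⟨e, rfl, rfl⟩, rfl⟩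
    exact ⟨R.onE e, ⟨R.onE_notMem e, (R.map_s e).symm⟩, (R.map_t e).symm⟩
  · rintro ⟨e, ⟨he, hs⟩, rfl⟩
    obtain ⟨e, rfl⟩ := R.exists_onE_eq he
    exact ⟨_, ⟨e, R.injV ((R.map_s e).trans hs), rfl⟩, R.map_t e⟩

namespace Edit.RemovesLeaves

variable {X : G.Edit} (hX : X.RemovesLeaves)

include hX

theorem noDangling : X.NoDangling := fun e he => ⟨hX.s_notMem e, fun h => he ((hX.t_mem_iff e).1 h)⟩

theorem reflTransGen_iff (R : X.Reduct H) {x y : H.V} :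
    ReflTransGen G.Step (R.onV x) (R.onV y) ↔ ReflTransGen H.Step x y := by
  constructor
  · suffices ∀ w, ReflTransGen G.Step (R.onV x) w → ∀ y, R.onV y = w → ReflTransGen H.Step x y from
      fun h => this _ h y rfl
    intro w h
    induction h with
    | refl => exact fun y hy => R.injV hy ▸ .refl
    | tail _ hw ih =>
      obtain ⟨e, rfl, rfl⟩ := hw
      intro y hy
      obtain ⟨e, rfl⟩ := R.exists_onE_eq fun he => R.onV_notMem y (hy ▸ (hX.t_mem_iff e).2 he)
      exact (ih (H.s e) (R.map_s e)).tail ⟨e, rfl, R.injV ((R.map_t e).trans hy.symm)⟩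
  · refine fun h => h.lift R.onV ?_
    rintro _ _ ⟨e, rfl, rfl⟩
    exact ⟨R.onE e, (R.map_s e).symm, (R.map_t e).symm⟩

theorem t_injective_iff (R : X.Reduct H) : Function.Injective G.t ↔ Function.Injective H.t := by
  constructor
  · intro h e e' he
    exact R.injE (h (by rw [← R.map_t, ← R.map_t, he]))
  · intro h e e' he
    by_cases hd : e ∈ X.delE
    · exact hX.t_injOn hd ((hX.t_mem_iff e').1 (he ▸ (hX.t_mem_iff e).2 hd)) he
    · obtain ⟨e, rfl⟩ := R.exists_onE_eq hd
      obtain ⟨e', rfl⟩ := R.exists_onE_eq fun hd' =>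
        hd ((hX.t_mem_iff _).1 (he ▸ (hX.t_mem_iff e').2 hd'))
      rw [← R.map_t, ← R.map_t, R.injV.eq_iff] at he
      rw [h he]

theorem forall_t_ne_iff (R : X.Reduct H) {x : H.V} :
    (∀ e, G.t e ≠ R.onV x) ↔ ∀ e, H.t e ≠ x := by
  constructor
  · rintro h e rfl
    exact h _ (R.map_t e).symm
  · intro h e he
    obtain ⟨e, rfl⟩ := R.exists_onE_eq fun hd => R.onV_notMem x (he ▸ (hX.t_mem_iff e).2 hd)
    exact h e (R.injV ((R.map_t e).trans he))

theorem isArborescence_iff (R : X.Reduct H) {x : H.V} :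
    G.IsArborescence (R.onV x) ↔ H.IsArborescence x := by
  constructor
  · exact fun h => ⟨(hX.forall_t_ne_iff R).1 h.t_ne, (hX.t_injective_iff R).1 h.t_inj,
      fun y => (hX.reflTransGen_iff R).1 (h.reachable _)⟩
  · refine fun h => ⟨(hX.forall_t_ne_iff R).2 h.t_ne, (hX.t_injective_iff R).2 h.t_inj, fun w => ?_⟩
    by_cases hw : w ∈ X.delV
    · obtain ⟨e, rfl⟩ := hX.exists_t_eq w hw
      obtain ⟨y, hy⟩ := R.exists_onV_eq (hX.s_notMem e)
      exact ((hX.reflTransGen_iff R).2 (h.reachable y)).tail (hy ▸ step e)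
    · obtain ⟨y, rfl⟩ := R.exists_onV_eq hw
      exact (hX.reflTransGen_iff R).2 (h.reachable y)

theorem exists_isArborescence_iff (R : X.Reduct H) :
    (∃ r, G.IsArborescence r) ↔ ∃ x, H.IsArborescence x := by
  refine ⟨fun ⟨r, hr⟩ => ?_, fun ⟨x, hx⟩ => ⟨_, (hX.isArborescence_iff R).2 hx⟩⟩
  obtain ⟨x, rfl⟩ := R.exists_onV_eq fun hd => (hX.exists_t_eq r hd).elim hr.t_ne
  exact ⟨x, (hX.isArborescence_iff R).1 hr⟩

/-- Full binary trees are preserved in both directions when the leaves are removed in pairs of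
siblings. -/
theorem isFullBinaryTree_iff (R : X.Reduct H)
    (hpair : ∀ v, (∀ e, G.s e = v → e ∉ X.delE) ∨
      (∀ e, G.s e = v → e ∈ X.delE) ∧ (G.children v).ncard = 2) :
    G.IsFullBinaryTree ↔ H.IsFullBinaryTree := by
  rw [RGraph.isFullBinaryTree_iff, RGraph.isFullBinaryTree_iff, hX.exists_isArborescence_iff R]
  refine and_congr_right fun _ => ?_
  have children_eq : ∀ v, (∀ e, G.s e = v → e ∉ X.delE) →
      G.t '' {e | e ∉ X.delE ∧ G.s e = v} = G.children v := fun v hv =>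
    congrArg _ (Set.ext fun e => and_iff_right_of_imp (hv e))
  constructor
  · intro h x
    rw [R.ncard_children]
    rcases hpair (R.onV x) with hx | ⟨hx, -⟩
    · rw [children_eq _ hx]
      exact h _
    · left
      have no_edge : {e | e ∉ X.delE ∧ G.s e = R.onV x} = ∅ :=
        Set.eq_empty_of_forall_notMem fun e he => he.1 (hx e he.2)
      rw [no_edge, Set.image_empty, Set.ncard_empty]
  · intro h v
    rcases hpair v with hv | ⟨-, hv⟩
    · by_cases hd : v ∈ X.delV
      · left
        have no_child : G.children v = ∅ :=
          Set.eq_empty_of_forall_notMem fun w ⟨e, he, _⟩ => hX.s_notMem e (he ▸ hd)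
        rw [no_child, Set.ncard_empty]
      · obtain ⟨x, rfl⟩ := R.exists_onV_eq hd
        rw [← children_eq _ hv, ← R.ncard_children]
        exact h x
    · exact .inr hv

end Edit.RemovesLeaves

theorem Edit.Reduct.isFullBinaryTree_iff_of_eq_empty {X : G.Edit} (R : X.Reduct H) (hV : X.delV = ∅)
    (hE : X.delE = ∅) : G.IsFullBinaryTree ↔ H.IsFullBinaryTree :=
  (Edit.removesLeaves_of_eq_empty hV hE).isFullBinaryTree_iff R fun _ =>
    .inl fun e _ => hE ▸ Set.notMem_empty e

theorem Iso.isFullBinaryTree_iff (f : Iso G H) : G.IsFullBinaryTree ↔ H.IsFullBinaryTree :=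
  ((Edit.unchangedReduct G).transIso f).isFullBinaryTree_iff_of_eq_empty rfl rfl

end RGraph

/-! ## Invariants of derivations -/

namespace RGraph

variable {LV LE : Type} {G H : RGraph LV LE} {b : ℕ}

theorem Edit.Reduct.degreeBounded {X : G.Edit} (R : X.Reduct H) (hG : G.DegreeBounded b) :
    H.DegreeBounded b := by
  have := G.finE
  intro x
  refine (Nat.add_le_add ?_ ?_).trans (hG (R.onV x))
  · exact Nat.card_le_card_of_injective
      (fun e => (⟨R.onE e.1, by rw [← R.map_t, e.2]⟩ : {e : G.E // G.t e = R.onV x}))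
      fun e e' he => Subtype.ext (R.injE (congrArg Subtype.val he))
  · exact Nat.card_le_card_of_injective
      (fun e => (⟨R.onE e.1, by rw [← R.map_s, e.2]⟩ : {e : G.E // G.s e = R.onV x}))
      fun e e' he => Subtype.ext (R.injE (congrArg Subtype.val he))

theorem Iso.degreeBounded (f : Iso G H) (hG : G.DegreeBounded b) : H.DegreeBounded b :=
  ((Edit.unchangedReduct G).transIso f).degreeBounded hG

theorem Iso.order_eq (f : Iso G H) : G.order = H.order := Nat.card_congr f.onV

end RGraph

namespace FBT

open NLabel RGraph Relation

variable {G H : RGraph NLabel ELabel} {v : G.V} {X : Move G} {n b : ℕ}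

namespace Cherry

variable {e₁ e₂ : G.E}

theorem removesLeaves (h : Cherry G v e₁ e₂) {X : G.Edit} (hV : X.delV = {G.t e₁, G.t e₂})
    (hE : X.delE = {e₁, e₂}) : X.RemovesLeaves where
  s_notMem e := by
    rw [hV]
    exact not_or.2 ⟨h.leaf₁ e, h.leaf₂ e⟩
  t_mem_iff e := by
    rw [hV, hE]
    exact ⟨Or.imp (h.in₁ e) (h.in₂ e), Or.imp (congrArg G.t) (congrArg G.t)⟩
  t_injOn := by
    rw [hE]
    exact Set.injOn_pair.2 fun h' => absurd h' h.t_ne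
  exists_t_eq w hw := by
    rw [hV] at hw
    rcases hw with rfl | rfl
    · exact ⟨e₁, rfl⟩
    · exact ⟨e₂, rfl⟩

theorem children_eq (h : Cherry G v e₁ e₂) : G.children v = {G.t e₁, G.t e₂} := by
  ext w
  constructor
  · rintro ⟨f, hf, rfl⟩
    exact (h.out f hf).imp (congrArg G.t) (congrArg G.t)
  · rintro (rfl | rfl)
    · exact ⟨e₁, h.s₁, rfl⟩
    · exact ⟨e₂, h.s₂, rfl⟩

theorem isFullBinaryTree_iff (h : Cherry G v e₁ e₂) {X : G.Edit}
    (hV : X.delV = {G.t e₁, G.t e₂}) (hE : X.delE = {e₁, e₂}) (R : X.Reduct H) :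
    G.IsFullBinaryTree ↔ H.IsFullBinaryTree := by
  refine (h.removesLeaves hV hE).isFullBinaryTree_iff R fun w => ?_
  rw [hE]
  by_cases hw : w = v
  · rw [hw, h.children_eq]
    exact .inr ⟨h.out, Set.ncard_pair h.t_ne⟩
  · left
    rintro e rfl (rfl | rfl)
    · exact hw h.s₁
    · exact hw h.s₂

end Cherry

/-- The vertex `v` has an outgoing edge or no incoming edge. -/
def HasExit (G : RGraph NLabel ELabel) (v : G.V) : Prop := (∃ e, G.s e = v) ∨ ∀ e, G.t e ≠ v

/-- The invariant of derivations from input graphs: a directed path leads from every triangle to the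
root, and the root has an exit as soon as there is a triangle. -/
structure IsMarkedAt (G : RGraph NLabel ELabel) (v : G.V) : Prop where
  rootedAt : RootedAt G v
  reaches_root : ∀ w, G.l w = some tri → ReflTransGen G.Step w v
  exit : HasExit G v ∨ ∀ w, G.l w = some box

/-- The number of square nodes. -/
noncomputable def numBoxes (G : RGraph NLabel ELabel) : ℕ := {w | G.l w = some box}.ncard

theorem numBoxes_le_order (G : RGraph NLabel ELabel) : numBoxes G ≤ G.order :=
  have := G.finV
  Set.ncard_le_card _

theorem numBoxes_eq_ncard {X : G.Edit} (R : X.Reduct H) :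
    numBoxes H = {w | w ∉ X.delV ∧ X.l w = some box}.ncard := by
  rw [numBoxes, ← Set.ncard_image_of_injective _ R.injV]
  congr 1
  ext w
  constructor
  · rintro ⟨x, hx, rfl⟩
    exact ⟨R.onV_notMem x, (R.map_l x).symm.trans hx⟩
  · rintro ⟨hw, hl⟩
    obtain ⟨x, rfl⟩ := R.exists_onV_eq hw
    exact ⟨x, (R.map_l x).trans hl, rfl⟩

theorem Move.edit_l_site (X : Move G) : X.edit.l X.site = some X.label := by
  classical exact Function.update_self X.site _ _

theorem Move.edit_l_of_ne {w : G.V} (hw : w ≠ X.site) : X.edit.l w = G.l w := by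
  classical exact Function.update_of_ne hw _ _

/-- In a path that ends at `v`, the last step takes the only edge into `v`. -/
theorem reflTransGen_source {e : G.E} {w : G.V} (in_unique : ∀ f, G.t f = v → f = e) (hw : w ≠ v)
    (h : ReflTransGen G.Step w v) : ReflTransGen G.Step w (G.s e) := by
  obtain rfl | ⟨_, hpath, f, rfl, hf⟩ := h.cases_tail
  · exact absurd rfl hw
  · rwa [in_unique f hf] at hpath

namespace Redex

theorem removesLeaves (hX : Redex G v X) : X.edit.RemovesLeaves := by
  cases hX with
  | top cherry => exact cherry.removesLeaves rfl rfl
  | prune cherry => exact cherry.removesLeaves rfl rfl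
  | descend => exact Edit.removesLeaves_of_eq_empty rfl rfl
  | ascend => exact Edit.removesLeaves_of_eq_empty rfl rfl

theorem isFullBinaryTree_iff (hX : Redex G v X) (R : X.edit.Reduct H) :
    G.IsFullBinaryTree ↔ H.IsFullBinaryTree := by
  cases hX with
  | top cherry => exact cherry.isFullBinaryTree_iff rfl rfl R
  | prune cherry => exact cherry.isFullBinaryTree_iff rfl rfl R
  | descend => exact R.isFullBinaryTree_iff_of_eq_empty rfl rfl
  | ascend => exact R.isFullBinaryTree_iff_of_eq_empty rfl rfl

theorem root_notMem (hX : Redex G v X) : X.root ∉ X.delV := by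
  cases hX with
  | top cherry => exact not_or.2 ⟨cherry.ne_root₁.symm, cherry.ne_root₂.symm⟩
  | prune cherry => exact not_or.2 ⟨cherry.leaf₁ _, cherry.leaf₂ _⟩
  | descend => exact Set.notMem_empty _
  | ascend => exact Set.notMem_empty _

theorem edit_l_root (hX : Redex G v X) : X.edit.l X.root = some box := by
  cases hX with
  | top => exact Move.edit_l_site _
  | prune => exact Move.edit_l_site _
  | descend path => exact (Move.edit_l_of_ne path.t_ne).trans path.l_child
  | ascend => exact Move.edit_l_site _

theorem rootedAt (hX : Redex G v X) (hl : ∀ w, G.l w ≠ none) (R : X.edit.Reduct H) {x : H.V}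
    (hx : R.onV x = X.root) : RootedAt H x where
  l_ne_none := (Move.isTLRG_of_reduct R hl).1
  l_root := by rw [R.map_l, hx, hX.edit_l_root]
  p_eq w := by
    rw [R.map_p]
    refine congrArg some (decide_eq_decide.2 ?_)
    rw [← hx, R.injV.eq_iff]

theorem hasExit (hX : Redex G v X) (R : X.edit.Reduct H) {x : H.V} (hx : R.onV x = X.root) :
    HasExit H x := by
  have exit_of_source {e : G.E} (he : e ∉ X.delE) (hs : G.s e = X.root) : HasExit H x := by
    obtain ⟨f, rfl⟩ := R.exists_onE_eq he
    exact .inl ⟨f, R.injV ((R.map_s f).trans (hs.trans hx.symm))⟩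
  cases hX with
  | top _ no_in => exact .inr fun e he => no_in (R.onE e) (by rw [← R.map_t, he, hx])
  | prune cherry t_eq =>
    refine exit_of_source (not_or.2 ⟨?_, ?_⟩) rfl
    · exact fun he => cherry.ne_root₁ (he ▸ t_eq)
    · exact fun he => cherry.ne_root₂ (he ▸ t_eq)
  | descend path => exact exit_of_source (Set.notMem_empty _) path.s_eq'
  | ascend => exact exit_of_source (Set.notMem_empty _) rfl

theorem reflTransGen_root (hX : Redex G v X) (hv : IsMarkedAt G v) {w : G.V}
    (hw : X.edit.l w = some tri) : ReflTransGen G.Step w X.root := by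
  have path_to_root (hlabel : X.label = box) : w ≠ v ∧ ReflTransGen G.Step w v := by
    have hsite : w ≠ X.site := fun h => by
      simp only [h, Move.edit_l_site, hlabel, Option.some.injEq, reduceCtorEq] at hw
    rw [Move.edit_l_of_ne hsite] at hw
    refine ⟨fun h => ?_, hv.reaches_root w hw⟩
    simp only [h, hv.rootedAt.l_root, Option.some.injEq, reduceCtorEq] at hw
  cases hX with
  | top => exact (path_to_root rfl).2
  | prune _ _ in_unique =>
    exact reflTransGen_source in_unique (path_to_root rfl).1 (path_to_root rfl).2
  | @descend e _ path =>
    have reaches_v : ReflTransGen G.Step w v := by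
      by_cases hwv : w = v
      · rw [hwv]
      · rw [Move.edit_l_of_ne hwv] at hw
        exact hv.reaches_root w hw
    exact reaches_v.tail ⟨e, path.s_eq, rfl⟩
  | ascend _ _ _ in_unique =>
    exact reflTransGen_source in_unique (path_to_root rfl).1 (path_to_root rfl).2

theorem exists_isMarkedAt (hX : Redex G v X) (hv : IsMarkedAt G v) (R : X.edit.Reduct H) :
    ∃ x, IsMarkedAt H x ∧ HasExit H x := by
  obtain ⟨x, hx⟩ := R.exists_onV_eq hX.root_notMem
  have exit := hX.hasExit R hx
  refine ⟨x, ⟨hX.rootedAt hv.rootedAt.l_ne_none R hx, fun y hy => ?_, .inl exit⟩, exit⟩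
  rw [← hX.removesLeaves.reflTransGen_iff R, hx]
  exact hX.reflTransGen_root hv ((R.map_l y).symm.trans hy)

end Redex

theorem Cherry.numBoxes_lt {e₁ e₂ : G.E} (h : Cherry G v e₁ e₂) {X : G.Edit}
    (hV : X.delV = {G.t e₁, G.t e₂}) {u : G.V} (hl : ∀ w ≠ u, X.l w = G.l w) (R : X.Reduct H) :
    numBoxes H < numBoxes G := by
  have := G.finV
  have boxes_subset : {w | w ∉ X.delV ∧ X.l w = some box} ⊆
      insert u ({w | G.l w = some box} \ {G.t e₁, G.t e₂}) := by
    rintro w ⟨hw, hbox⟩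
    rw [hV] at hw
    by_cases hwu : w = u
    · exact .inl hwu
    · exact .inr ⟨(hl w hwu).symm.trans hbox, hw⟩
  have leaves_subset : {G.t e₁, G.t e₂} ⊆ {w | G.l w = some box} :=
    Set.pair_subset h.l₁ h.l₂
  have card_le := (Set.ncard_le_ncard boxes_subset).trans (Set.ncard_insert_le _ _)
  have card_sdiff := Set.ncard_sdiff_add_ncard_of_subset leaves_subset
  rw [Set.ncard_pair h.t_ne] at card_sdiff
  rw [numBoxes_eq_ncard R, numBoxes]
  omega

/-- Every step removes a square, except a step upwards from a root without exit. -/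
theorem Redex.numBoxes_lt_or_eq (hX : Redex G v X) (hv : RootedAt G v) (R : X.edit.Reduct H) :
    numBoxes H < numBoxes G ∨ numBoxes H = numBoxes G ∧ ¬ HasExit G v := by
  have := G.finV
  cases hX with
  | top cherry => exact .inl (cherry.numBoxes_lt rfl (fun _ => Move.edit_l_of_ne) R)
  | prune cherry => exact .inl (cherry.numBoxes_lt rfl (fun _ => Move.edit_l_of_ne) R)
  | @descend e =>
    left
    have site_ne {w : G.V} (hw : (Move.edit ⟨∅, ∅, G.t e, v, tri⟩).l w = some box) : w ≠ v := by
      rintro rfl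
      exact absurd ((Move.edit_l_site ⟨∅, ∅, G.t e, w, tri⟩).symm.trans hw) (by simp)
    rw [numBoxes_eq_ncard R]
    refine Set.ncard_lt_ncard ((Set.ssubset_iff_of_subset ?_).2 ⟨v, hv.l_root, ?_⟩)
    · exact fun w hw => (Move.edit_l_of_ne (site_ne hw.2)).symm.trans hw.2
    · exact fun hw => site_ne hw.2 rfl
  | @ascend e t_eq l_parent no_out =>
    refine .inr ⟨?_, not_or.2 ⟨fun ⟨f, hf⟩ => no_out f hf, fun h => h e t_eq⟩⟩
    rw [numBoxes_eq_ncard R, numBoxes]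
    congr 1
    ext w
    refine (and_iff_right (Set.notMem_empty w)).trans ?_
    by_cases hw : w = G.s e
    · rw [hw, Move.edit_l_site ⟨∅, ∅, G.s e, G.s e, box⟩]
      exact iff_of_true rfl l_parent
    · rw [Move.edit_l_of_ne hw]
      rfl

theorem IsInput.exists_isMarkedAt (hG : IsInput G) : ∃ v, IsMarkedAt G v := by
  classical
  obtain ⟨total, ⟨v, hv, root_unique⟩, l_box, -⟩ := hG
  refine ⟨v, ⟨total.1, l_box v, fun w => ?_⟩, fun w hw => ?_, .inr l_box⟩
  · obtain ⟨c, hc⟩ := Option.ne_none_iff_exists'.1 (total.2 w)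
    have root_iff : c = true ↔ w = v := by
      refine ⟨fun h => root_unique w (hc.trans (congrArg some h)), ?_⟩
      rintro rfl
      exact Option.some_injective _ (hc.symm.trans hv)
    refine hc.trans (congrArg some (Bool.eq_iff_iff.2 (root_iff.trans ?_)))
    exact decide_eq_true_iff.symm
  · exact absurd ((l_box w).symm.trans hw) (by simp)

theorem IsInput.of_iso (hG : IsInput G) (f : Iso G H) : IsInput H := by
  obtain ⟨total, ⟨v, hv, root_unique⟩, l_box, -⟩ := hG
  refine ⟨⟨f.onV.surjective.forall.2 fun w => ?_, f.onV.surjective.forall.2 fun w => ?_⟩,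
    ⟨f.onV v, ?_, f.onV.surjective.forall.2 fun w hw => ?_⟩,
    f.onV.surjective.forall.2 fun w => ?_, fun _ => rfl⟩
  · rw [← f.map_l]
    exact total.1 w
  · rw [← f.map_p]
    exact total.2 w
  · exact (f.map_p v).symm.trans hv
  · rw [root_unique w ((f.map_p w).trans hw)]
  · exact (f.map_l w).symm.trans (l_box w)

theorem exists_isMarkedAt_of_derivesIn (hG : IsInput G) (hd : DerivesIn rules n G H) :
    ∃ v, IsMarkedAt H v ∧ (n = 0 ∧ numBoxes H ≤ G.order ∨
      n + numBoxes H ≤ G.order + 1 ∧ HasExit H v) := by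
  induction hd with
  | @zero G H hi =>
    obtain ⟨f⟩ := hi.exists_iso hG.1
    obtain ⟨v, hv⟩ := (hG.of_iso f).exists_isMarkedAt
    exact ⟨v, hv, .inl ⟨rfl, (numBoxes_le_order H).trans_eq f.order_eq.symm⟩⟩
  | @succ n G H H' _ hd ih =>
    obtain ⟨v, hv, bound⟩ := ih hG
    obtain ⟨X, hX, ⟨R⟩⟩ := hv.rootedAt.directlyDerives_iff.1 hd
    obtain ⟨w, hw, exit⟩ := hX.exists_isMarkedAt hv R
    refine ⟨w, hw, .inr ⟨?_, exit⟩⟩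
    rcases hX.numBoxes_lt_or_eq hv.rootedAt R with hlt | ⟨heq, no_exit⟩
    · omega
    · rcases bound with bound | ⟨-, exit_v⟩
      · omega
      · exact absurd exit_v no_exit

theorem exists_redex_of_derivesIn (hG : IsInput G) {H' : RGraph NLabel ELabel}
    (hd : DerivesIn rules n G H) (hd' : DirectlyDerives rules H H') :
    ∃ (v : H.V) (X : Move H), Redex H v X ∧ Nonempty (X.edit.Reduct H') := by
  obtain ⟨v, hv, -⟩ := exists_isMarkedAt_of_derivesIn hG hd
  exact ⟨v, hv.rootedAt.directlyDerives_iff.1 hd'⟩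

theorem isFullBinaryTree_iff_of_derivesIn (hG : IsInput G) (hd : DerivesIn rules n G H) :
    G.IsFullBinaryTree ↔ H.IsFullBinaryTree := by
  induction hd with
  | zero hi =>
    obtain ⟨f⟩ := hi.exists_iso hG.1
    exact f.isFullBinaryTree_iff
  | succ hd hd' ih =>
    obtain ⟨v, X, hX, ⟨R⟩⟩ := exists_redex_of_derivesIn hG hd hd'
    exact (ih hG).trans (hX.isFullBinaryTree_iff R)

theorem degreeBounded_of_derivesIn (hG : IsInput G) (hb : G.DegreeBounded b)
    (hd : DerivesIn rules n G H) : H.DegreeBounded b := by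
  induction hd with
  | zero hi =>
    obtain ⟨f⟩ := hi.exists_iso hG.1
    exact f.degreeBounded hb
  | succ hd hd' ih =>
    obtain ⟨v, X, -, ⟨R⟩⟩ := exists_redex_of_derivesIn hG hd hd'
    exact R.degreeBounded (ih hG hb)

/-! ## Termination -/

theorem order_pos (hG : IsInput G) : 0 < G.order := by
  have := G.finV
  obtain ⟨v, -⟩ := hG.exists_isMarkedAt
  have : Nonempty G.V := ⟨v⟩
  exact Nat.card_pos

theorem length_le (hG : IsInput G) (hd : DerivesIn rules n G H) : n ≤ 2 * G.order := by
  obtain ⟨v, -, bound⟩ := exists_isMarkedAt_of_derivesIn hG hd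
  have := order_pos hG
  omega

theorem not_exists_infinite (hG : IsInput G) :
    ¬ ∃ f : ℕ → RGraph NLabel ELabel, f 0 = G ∧ ∀ i, DirectlyDerives rules (f i) (f (i + 1)) := by
  rintro ⟨f, rfl, hf⟩
  have derivesIn (n : ℕ) : DerivesIn rules n (f 0) (f n) := by
    induction n with
    | zero => exact .zero (Iso.refl _).isomorphic
    | succ n ih => exact .succ ih (hf n)
  exact absurd (length_le hG (derivesIn (2 * (f 0).order + 1))) (Nat.not_succ_le_self _)

theorem exists_isNormalFormOf (hG : IsInput G) : ∃ H, IsNormalFormOf rules H G := by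
  by_contra! no_normal_form
  have exists_derivesIn (n : ℕ) : ∃ H, DerivesIn rules n G H := by
    induction n with
    | zero => exact ⟨G, .zero (Iso.refl G).isomorphic⟩
    | succ n ih =>
      obtain ⟨H, hH⟩ := ih
      by_contra! no_step
      exact no_normal_form H ⟨⟨n, hH⟩, fun H' hH' => no_step H' (.succ hH hH')⟩
  obtain ⟨H, hH⟩ := exists_derivesIn (2 * G.order + 1)
  exact absurd (length_le hG hH) (Nat.not_succ_le_self _)

/-! ## Normal forms -/

theorem IsMarkedAt.l_eq_box (hv : IsMarkedAt G v) (hG : ∀ u, ¬ TransGen G.Step u u) {w : G.V}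
    (hw : TransGen G.Step v w) : G.l w = some box := by
  rcases hl : G.l w with _ | _ | _
  · exact absurd hl (hv.rootedAt.l_ne_none w)
  · rfl
  · exact absurd (hw.trans_left (hv.reaches_root w hl)) (hG v)

theorem exists_cherry (hin : Function.Injective G.t)
    (hbox : ∀ w, TransGen G.Step v w → G.l w = some box) (hv : (G.children v).ncard = 2)
    (hleaf : ∀ e, G.s e = v → ∀ f, G.s f ≠ G.t e) : ∃ e₁ e₂, Cherry G v e₁ e₂ := by
  obtain ⟨w₁, w₂, hne, hpair⟩ := Set.ncard_eq_two.1 hv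
  obtain ⟨e₁, s₁, rfl⟩ : w₁ ∈ G.children v := hpair ▸ Set.mem_insert _ _
  obtain ⟨e₂, s₂, rfl⟩ : w₂ ∈ G.children v := hpair ▸ Set.mem_insert_of_mem _ rfl
  refine ⟨e₁, e₂, s₁, s₂, hne, hbox _ (.single ⟨e₁, s₁, rfl⟩), hbox _ (.single ⟨e₂, s₂, rfl⟩),
    fun f hf => ?_, hleaf e₁ s₁, hleaf e₂ s₂, fun f hf => hin hf, fun f hf => hin hf⟩
  have : G.t f ∈ G.children v := ⟨f, hf, rfl⟩
  rw [hpair] at this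
  exact this.imp (@hin _ _) (@hin _ _)

theorem IsMarkedAt.exists_redex (hv : IsMarkedAt G v) (hG : G.IsFullBinaryTree)
    (h : ∃ e, G.s e = v ∨ G.t e = v) : ∃ X, Redex G v X := by
  obtain ⟨⟨r, hr⟩, two_children⟩ := isFullBinaryTree_iff.1 hG
  have in_unique {e f : G.E} (he : G.t e = v) (hf : G.t f = v) : f = e :=
    hr.t_inj (hf.trans he.symm)
  have acyclic := hr.not_transGen_self
  by_cases no_out : ∀ e, G.s e ≠ v
  · obtain ⟨e, he⟩ := h
    have t_eq := he.resolve_left (no_out e)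
    refine ⟨_, .ascend t_eq ?_ no_out fun f => in_unique t_eq⟩
    rcases hv.exit with (⟨f, hf⟩ | no_in) | l_box
    · exact absurd hf (no_out f)
    · exact absurd t_eq (no_in e)
    · exact l_box _
  · by_cases hleaf : ∀ e, G.s e = v → ∀ f, G.s f ≠ G.t e
    · have hcard : (G.children v).ncard = 2 := by
        refine (two_children v).resolve_left fun h0 => no_out fun e he => ?_
        have := G.finV
        exact ((Set.ncard_eq_zero).1 h0).subset ⟨e, he, rfl⟩
      obtain ⟨e₁, e₂, cherry⟩ := exists_cherry hr.t_inj (fun _ => hv.l_eq_box acyclic) hcard hleaf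
      by_cases hin : ∃ e, G.t e = v
      · obtain ⟨e, t_eq⟩ := hin
        exact ⟨_, .prune cherry t_eq fun f => in_unique t_eq⟩
      · exact ⟨_, .top cherry fun e he => hin ⟨e, he⟩⟩
    · push Not at hleaf
      obtain ⟨e, rfl, e', s_eq'⟩ := hleaf
      have child : G.Step (G.s e) (G.t e) := step e
      have grandchild : G.Step (G.t e) (G.t e') := s_eq' ▸ step e'
      have l_box (w : G.V) := hv.l_eq_box acyclic (w := w)
      refine ⟨_, .descend ⟨rfl, s_eq', fun h => ?_, fun h => ?_, fun h => ?_,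
        l_box _ (.single child), l_box _ (.tail (.single child) grandchild)⟩⟩
      · exact acyclic _ (.single (h ▸ child))
      · exact acyclic _ (.tail (.single child) (h ▸ grandchild))
      · exact acyclic _ (.single (h ▸ grandchild))

theorem isomorphic_single_of_isolated (hv : RootedAt G v) {r : G.V} (hr : G.IsArborescence r)
    (hs : ∀ e, G.s e ≠ v) (ht : ∀ e, G.t e ≠ v) : G.Isomorphic single := by
  have root_eq : v = r := (hr.reachable v).cases_tail.resolve_right fun ⟨_, _, e, _, he⟩ => ht e he
  have eq_root (w : G.V) : w = v := by
    obtain h | ⟨_, ⟨e, he, _⟩, _⟩ := (hr.reachable w).cases_head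
    · exact h.symm.trans root_eq.symm
    · exact absurd (he.trans root_eq.symm) (hs e)
  have : IsEmpty G.E := ⟨fun e => hs e (eq_root _)⟩
  have : IsEmpty single.E := Fin.isEmpty
  have : Unique G.V := ⟨⟨v⟩, eq_root⟩
  have : Unique single.V := inferInstanceAs (Unique (Fin 1))
  refine Iso.isomorphic
    { onV := .ofUnique _ _
      onE := .equivOfIsEmpty _ _
      map_s := isEmptyElim
      map_t := isEmptyElim
      map_m := isEmptyElim
      map_l := fun w => ?_
      map_p := fun w => ?_ }
  · rw [eq_root w]
    exact hv.l_root
  · rw [eq_root w]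
    exact hv.p_eq_true_iff.2 rfl

theorem isFullBinaryTree_single : single.IsFullBinaryTree := by
  have no_edge : IsEmpty single.E := Fin.isEmpty
  have : Subsingleton single.V := inferInstanceAs (Subsingleton (Fin 1))
  refine isFullBinaryTree_iff.2 ⟨⟨(0 : Fin 1), isEmptyElim, isEmptyElim, fun w => ?_⟩, fun w => ?_⟩
  · rw [Subsingleton.elim w (0 : Fin 1)]
    exact .refl
  · left
    have no_child : single.children w = ∅ :=
      Set.eq_empty_of_forall_notMem fun _ ⟨e, _⟩ => no_edge.elim e
    rw [no_child, Set.ncard_empty]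

theorem isFullBinaryTree_unlabelled_iff (G : RGraph NLabel ELabel) :
    (unlabelled G).IsFullBinaryTree ↔ G.IsFullBinaryTree :=
  let R : Edit.Reduct (G := G) ⟨∅, ∅, fun _ => some box, fun _ => some false⟩ (unlabelled G) :=
    { onV := id
      onE := id
      injV := Function.injective_id
      injE := Function.injective_id
      range_onV := Set.range_id.trans Set.compl_empty.symm
      range_onE := Set.range_id.trans Set.compl_empty.symm
      map_s := fun _ => rfl
      map_t := fun _ => rfl
      map_m := fun _ => rfl
      map_l := fun _ => rfl
      map_p := fun _ => rfl }
  (R.isFullBinaryTree_iff_of_eq_empty rfl rfl).symm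

theorem isomorphic_single_iff (hG : IsInput G) (hH : IsNormalFormOf rules H G) :
    H.Isomorphic single ↔ (unlabelled G).IsFullBinaryTree := by
  obtain ⟨⟨n, hd⟩, normal⟩ := hH
  obtain ⟨v, hv, -⟩ := exists_isMarkedAt_of_derivesIn hG hd
  rw [isFullBinaryTree_unlabelled_iff, isFullBinaryTree_iff_of_derivesIn hG hd]
  constructor
  · intro hi
    obtain ⟨f⟩ := hi.exists_iso hv.rootedAt.isTLRG
    exact f.isFullBinaryTree_iff.2 isFullBinaryTree_single
  · intro hH
    have isolated (e : H.E) : ¬ (H.s e = v ∨ H.t e = v) := fun he =>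
      have ⟨X, hX⟩ := hv.exists_redex hH ⟨e, he⟩
      hv.rootedAt.inNormalForm_iff.1 normal X hX
    obtain ⟨⟨r, hr⟩, -⟩ := isFullBinaryTree_iff.1 hH
    exact isomorphic_single_of_isolated hv.rootedAt hr (fun e h => isolated e (.inl h))
      fun e h => isolated e (.inr h)

end FBT

/-! ## Copies of graphs in the store -/

namespace RGraph

variable {LV LE : Type} {G : RGraph LV LE} {v : G.V}

theorem outdeg_eq_zero_iff : G.outdeg v = 0 ↔ ∀ e, G.s e ≠ v := by
  have := G.finE
  rw [outdeg, Finite.card_eq_zero_iff, isEmpty_subtype]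

theorem indeg_eq_zero_iff : G.indeg v = 0 ↔ ∀ e, G.t e ≠ v := by
  have := G.finE
  rw [indeg, Finite.card_eq_zero_iff, isEmpty_subtype]

theorem indeg_eq_one_iff : G.indeg v = 1 ↔ ∃ e, G.t e = v ∧ ∀ d, G.t d = v → d = e := by
  simp only [indeg, Nat.card_eq_one_iff_exists, Subtype.exists, Subtype.forall, Subtype.mk.injEq,
    exists_prop]

theorem outdeg_eq_two {e₁ e₂ : G.E} (hne : e₁ ≠ e₂) (h : ∀ e, G.s e = v ↔ e = e₁ ∨ e = e₂) :
    G.outdeg v = 2 := by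
  rw [outdeg, Nat.card_eq_two_iff]
  refine ⟨⟨e₁, (h _).2 (.inl rfl)⟩, ⟨e₂, (h _).2 (.inr rfl)⟩, fun he => hne (congrArg (·.1) he),
    Set.eq_univ_of_forall fun e => ?_⟩
  exact ((h _).1 e.2).imp Subtype.ext Subtype.ext

end RGraph

namespace GraphMachine

open RGraph

variable {LV LE : Type} {G H : RGraph LV LE} {S S' : Store LV LE} {f : G.V → ℕ} {h : G.E → ℕ}

theorem length_eq_card_subtype {α : Type*} {p : α → Prop} {l : List α}
    (nodup : l.Nodup) (mem_iff : ∀ a, a ∈ l ↔ p a) : l.length = Nat.card {a // p a} := by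
  classical
  rw [← List.toFinset_card_of_nodup nodup]
  exact (Nat.subtype_card _ fun a => List.mem_toFinset.trans (mem_iff a)).symm

namespace Store

/-- The store `S` holds a copy of `G` under the names given by `f` and `h`. -/
structure IsCopy (S : Store LV LE) (G : RGraph LV LE) (f : G.V → ℕ) (h : G.E → ℕ) : Prop where
  injV : Function.Injective f
  injE : Function.Injective h
  rangeV : Set.range f = ↑S.nodes
  rangeE : Set.range h = ↑S.edges
  src : ∀ e, S.src (h e) = f (G.s e)
  tgt : ∀ e, S.tgt (h e) = f (G.t e)
  edgeLab : ∀ e, S.edgeLab (h e) = G.m e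
  lab : ∀ v, G.l v = some (S.lab (f v))
  root : ∀ v, G.p v = some (S.root (f v))

theorem Represents.exists_isCopy (hS : S.Represents G) : ∃ f h, S.IsCopy G f h := by
  obtain ⟨f, h, injV, injE, rangeV, rangeE, src, tgt, edgeLab, lab, root⟩ := hS
  exact ⟨f, h, injV, injE, rangeV, rangeE, src, tgt, edgeLab, lab, root⟩

namespace IsCopy

theorem represents (hS : S.IsCopy G f h) : S.Represents G :=
  ⟨f, h, hS.injV, hS.injE, hS.rangeV, hS.rangeE, hS.src, hS.tgt, hS.edgeLab, hS.lab, hS.root⟩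

theorem represents_reduct (hS : S.IsCopy G f h) {X : Edit G} (R : X.Reduct H)
    (nodes : ↑S'.nodes = f '' X.delVᶜ) (edges : ↑S'.edges = h '' X.delEᶜ) (src : S'.src = S.src)
    (tgt : S'.tgt = S.tgt) (edgeLab : S'.edgeLab = S.edgeLab)
    (lab : ∀ w, X.l w = some (S'.lab (f w))) (root : ∀ w, X.p w = some (S'.root (f w))) :
    S'.Represents H := by
  refine ⟨f ∘ R.onV, h ∘ R.onE, hS.injV.comp R.injV, hS.injE.comp R.injE, ?_, ?_, fun e => ?_,
    fun e => ?_, fun e => ?_, fun w => (R.map_l w).trans (lab _),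
    fun w => (R.map_p w).trans (root _)⟩
  · rw [Set.range_comp, R.range_onV, nodes]
  · rw [Set.range_comp, R.range_onE, edges]
  · rw [src, Function.comp_apply, hS.src, ← R.map_s, Function.comp_apply]
  · rw [tgt, Function.comp_apply, hS.tgt, ← R.map_t, Function.comp_apply]
  · rw [edgeLab, Function.comp_apply, hS.edgeLab, R.map_m]

theorem mem_nodes (hS : S.IsCopy G f h) (v : G.V) : f v ∈ S.nodes := by
  rw [← Finset.mem_coe, ← hS.rangeV]
  exact Set.mem_range_self v

theorem mem_edges (hS : S.IsCopy G f h) (e : G.E) : h e ∈ S.edges := by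
  rw [← Finset.mem_coe, ← hS.rangeE]
  exact Set.mem_range_self e

theorem exists_node (hS : S.IsCopy G f h) {x : ℕ} (hx : x ∈ S.nodes) : ∃ v, f v = x := by
  rwa [← Finset.mem_coe, ← hS.rangeV] at hx

theorem exists_edge (hS : S.IsCopy G f h) {d : ℕ} (hd : d ∈ S.edges) : ∃ e, h e = d := by
  rwa [← Finset.mem_coe, ← hS.rangeE] at hd

theorem lab_eq_iff (hS : S.IsCopy G f h) {w : G.V} {a : LV} :
    S.lab (f w) = a ↔ G.l w = some a := by
  rw [hS.lab, Option.some.injEq]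

theorem exists_sort_filter_eq_map (hS : S.IsCopy G f h) (p : ℕ → Prop) [DecidablePred p] :
    ∃ l : List G.E, l.Nodup ∧ (∀ e, e ∈ l ↔ p (h e)) ∧
      (S.edges.filter p).sort (· ≤ ·) = l.map h := by
  have mem_iff (d : ℕ) : d ∈ (S.edges.filter p).sort (· ≤ ·) ↔ d ∈ S.edges ∧ p d := by
    rw [Finset.mem_sort, Finset.mem_filter]
  obtain ⟨l, hl⟩ : (S.edges.filter p).sort (· ≤ ·) ∈ Set.range (List.map h) := by
    rw [Set.range_list_map]
    exact fun d hd => hS.exists_edge ((mem_iff d).1 hd).1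
  refine ⟨l, .of_map h (hl ▸ Finset.sort_nodup _ _), fun e => ?_, hl.symm⟩
  rw [← List.mem_map_of_injective hS.injE, hl, mem_iff]
  exact and_iff_right (hS.mem_edges e)

theorem exists_outEdges_eq_map (hS : S.IsCopy G f h) (v : G.V) :
    ∃ l : List G.E, l.Nodup ∧ (∀ e, e ∈ l ↔ G.s e = v) ∧ S.outEdges (f v) = l.map h := by
  simpa only [outEdges, hS.src, hS.injV.eq_iff] using hS.exists_sort_filter_eq_map (S.src · = f v)

theorem exists_inEdges_eq_map (hS : S.IsCopy G f h) (v : G.V) :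
    ∃ l : List G.E, l.Nodup ∧ (∀ e, e ∈ l ↔ G.t e = v) ∧ S.inEdges (f v) = l.map h := by
  simpa only [inEdges, hS.tgt, hS.injV.eq_iff] using hS.exists_sort_filter_eq_map (S.tgt · = f v)

theorem length_outEdges (hS : S.IsCopy G f h) (v : G.V) :
    (S.outEdges (f v)).length = G.outdeg v := by
  obtain ⟨l, nodup, mem_iff, hl⟩ := hS.exists_outEdges_eq_map v
  rw [hl, List.length_map, length_eq_card_subtype nodup mem_iff, outdeg]

theorem length_inEdges (hS : S.IsCopy G f h) (v : G.V) :
    (S.inEdges (f v)).length = G.indeg v := by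
  obtain ⟨l, nodup, mem_iff, hl⟩ := hS.exists_inEdges_eq_map v
  rw [hl, List.length_map, length_eq_card_subtype nodup mem_iff, indeg]

theorem inEdges_eq_singleton (hS : S.IsCopy G f h) {e : G.E}
    (in_unique : ∀ d, G.t d = G.t e → d = e) : S.inEdges (f (G.t e)) = [h e] := by
  obtain ⟨l, -, mem_iff, hl⟩ := hS.exists_inEdges_eq_map (G.t e)
  have hlen : (l.map h).length = 1 := by
    rw [← hl, hS.length_inEdges]
    exact indeg_eq_one_iff.2 ⟨e, rfl, in_unique⟩
  rw [List.length_map, List.length_eq_one_iff] at hlen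
  obtain ⟨d, rfl⟩ := hlen
  rw [hl, in_unique d ((mem_iff d).1 (List.mem_singleton_self d)), List.map_singleton]

theorem exists_outEdges_eq_pair (hS : S.IsCopy G f h) {v : G.V} (h2 : G.outdeg v = 2) :
    ∃ e₁ e₂, S.outEdges (f v) = [h e₁, h e₂] ∧ e₁ ≠ e₂ ∧ ∀ e, G.s e = v ↔ e = e₁ ∨ e = e₂ := by
  obtain ⟨l, nodup, mem_iff, hl⟩ := hS.exists_outEdges_eq_map v
  rw [← hS.length_outEdges, hl, List.length_map, List.length_eq_two] at h2
  obtain ⟨e₁, e₂, rfl⟩ := h2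
  exact ⟨e₁, e₂, hl, List.pairwise_pair.1 nodup, fun e => by rw [← mem_iff, List.mem_pair]⟩

end IsCopy

end Store

/-! ## Timed execution -/

variable [DecidableEq LV] {P P' : Cmd LV LE} {σ : State LV LE} {T T₁ T₂ : ℕ}
  {Q Q' : State LV LE → Prop}

/-- Total correctness with a time bound: from `σ`, the command `P` halts within `T` steps in a state
with the property `Q`. -/
def HaltsWithin (P : Cmd LV LE) (σ : State LV LE) (T : ℕ) (Q : State LV LE → Prop) : Prop :=
  ∃ (t : ℕ) (σ' : State LV LE), Exec P σ t σ' ∧ t ≤ T ∧ Q σ'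

/-- Execute `P` if each of the tests in a list has the given outcome. -/
def guards (Bs : List (Test LV LE × Bool)) (P : Cmd LV LE) : Cmd LV LE :=
  Bs.foldr (fun B R => if B.2 then .ite B.1 R .skip else .ite B.1 .skip R) P

namespace HaltsWithin

theorem mono (hP : HaltsWithin P σ T₁ Q) (hT : T₁ ≤ T₂) (hQ : ∀ σ', Q σ' → Q' σ') :
    HaltsWithin P σ T₂ Q' := by
  obtain ⟨t, σ', exec, ht, hσ'⟩ := hP
  exact ⟨t, σ', exec, ht.trans hT, hQ _ hσ'⟩

theorem of_le (hP : HaltsWithin P σ T₁ Q) (hT : T₁ ≤ T₂) : HaltsWithin P σ T₂ Q :=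
  hP.mono hT fun _ => id

theorem seq (hP : HaltsWithin P σ T₁ fun σ' => HaltsWithin P' σ' T₂ Q) :
    HaltsWithin (.seq P P') σ (T₁ + T₂) Q := by
  obtain ⟨t, σ', exec, ht, t', σ'', exec', ht', hσ''⟩ := hP
  exact ⟨_, _, .seq _ _ _ _ _ _ _ exec exec', Nat.add_le_add ht ht', hσ''⟩

theorem ite {B : Test LV LE} (h_true : B.Holds σ → HaltsWithin P σ T Q)
    (h_false : ¬ B.Holds σ → HaltsWithin P' σ T Q) : HaltsWithin (.ite B P P') σ (1 + T) Q := by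
  by_cases hB : B.Holds σ
  · obtain ⟨t, σ', exec, ht, hσ'⟩ := h_true hB
    exact ⟨_, _, .iteTrue _ _ _ _ _ _ hB exec, Nat.add_le_add_left ht 1, hσ'⟩
  · obtain ⟨t, σ', exec, ht, hσ'⟩ := h_false hB
    exact ⟨_, _, .iteFalse _ _ _ _ _ _ hB exec, Nat.add_le_add_left ht 1, hσ'⟩

theorem skip (hσ : Q σ) : HaltsWithin .skip σ 1 Q := ⟨_, _, .skip σ, le_rfl, hσ⟩

theorem setFlag {i : ℕ} {c : Bool} (hσ : Q { σ with flag := Function.update σ.flag i c }) :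
    HaltsWithin (.setFlag i c) σ 1 Q := ⟨_, _, .setFlag σ i c, le_rfl, hσ⟩

theorem copyNode {x y : ℕ} (hσ : Q (σ.setNode x (σ.nreg y))) :
    HaltsWithin (.copyNode x y) σ 1 Q := ⟨_, _, .copyNode σ x y, le_rfl, hσ⟩

theorem copyEdge {x y : ℕ} (hσ : Q (σ.setEdge x (σ.ereg y))) :
    HaltsWithin (.copyEdge x y) σ 1 Q := ⟨_, _, .copyEdge σ x y, le_rfl, hσ⟩

theorem source {x i u : ℕ} (hu : σ.store.src (σ.ereg i) = u) (hσ : Q (σ.setNode x u)) :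
    HaltsWithin (.source x i) σ 1 Q := ⟨_, _, .source σ x i, le_rfl, hu ▸ hσ⟩

theorem target {x i u : ℕ} (hu : σ.store.tgt (σ.ereg i) = u) (hσ : Q (σ.setNode x u)) :
    HaltsWithin (.target x i) σ 1 Q := ⟨_, _, .target σ x i, le_rfl, hu ▸ hσ⟩

theorem relabel {x u : ℕ} {a : LV} (hx : σ.nreg x = u) (hu : u ∈ σ.store.nodes)
    (hT : σ.store.numRooted ≤ T)
    (hσ : Q { σ with store := { σ.store with lab := Function.update σ.store.lab u a } }) :
    HaltsWithin (.relabel x a) σ (1 + T) Q := by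
  subst hx
  exact ⟨_, _, .relabel σ x a hu, Nat.add_le_add_left hT 1, hσ⟩

theorem setRoot {x u : ℕ} {c : Bool} (hx : σ.nreg x = u) (hu : u ∈ σ.store.nodes)
    (hT : σ.store.numRooted ≤ T)
    (hσ : Q { σ with store := { σ.store with root := Function.update σ.store.root u c } }) :
    HaltsWithin (.setRoot x c) σ (1 + T) Q := by
  subst hx
  exact ⟨_, _, .setRoot σ x c hu, Nat.add_le_add_left hT 1, hσ⟩

theorem delNode {x u : ℕ} (hx : σ.nreg x = u) (hu : u ∈ σ.store.nodes)
    (isolated : ∀ d ∈ σ.store.edges, σ.store.src d ≠ u ∧ σ.store.tgt d ≠ u)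
    (hσ : Q { σ with store := { σ.store with nodes := σ.store.nodes.erase u } }) :
    HaltsWithin (.delNode x) σ 1 Q := by
  subst hx
  exact ⟨_, _, .delNode σ x hu isolated, le_rfl, hσ⟩

theorem delEdge {i d : ℕ} (hi : σ.ereg i = d) (hd : d ∈ σ.store.edges)
    (hσ : Q { σ with store := { σ.store with edges := σ.store.edges.erase d } }) :
    HaltsWithin (.delEdge i) σ 1 Q := by
  subst hi
  exact ⟨_, _, .delEdge σ i hd, le_rfl, hσ⟩

theorem guards {Bs : List (Test LV LE × Bool)} {C : Prop}
    (hC : (∀ B ∈ Bs, B.1.Holds σ ↔ B.2 = true) ↔ C) (h_true : C → HaltsWithin P σ T Q)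
    (h_false : ¬ C → Q σ) : HaltsWithin (guards Bs P) σ (Bs.length + (T + 1)) Q := by
  induction Bs generalizing C with
  | nil => exact (h_true (hC.1 fun _ h => absurd h List.not_mem_nil)).of_le (by omega)
  | cons B Bs ih =>
    rw [List.forall_mem_cons] at hC
    have pass (hB : B.1.Holds σ ↔ B.2 = true) :
        HaltsWithin (GraphMachine.guards Bs P) σ (Bs.length + (T + 1)) Q :=
      ih ((and_iff_right hB).symm.trans hC) h_true h_false
    have fail (hB : ¬ (B.1.Holds σ ↔ B.2 = true)) :
        HaltsWithin .skip σ (Bs.length + (T + 1)) Q :=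
      (skip (h_false fun h => hB (hC.2 h).1)).of_le (by omega)
    obtain ⟨B, _ | _⟩ := B
    · refine (ite (fun hB => fail ?_) fun hB => pass ?_).of_le
        (by rw [List.length_cons]; omega) <;> simp [hB]
    · refine (ite (fun hB => pass ?_) fun hB => fail ?_).of_le
        (by rw [List.length_cons]; omega) <;> simp [hB]

theorem forNodes_singleton {x v : ℕ} {a : LV} (hv : σ.store.nodesWith a true = [v])
    (hP : HaltsWithin P (σ.setNode x v) T Q) : HaltsWithin (.forNodes x a true P) σ (2 + T) Q := by
  obtain ⟨t, σ', exec, ht, hσ'⟩ := hP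
  refine ⟨1 + listTime σ.store a true + (t + 0), σ', .forNodes _ _ _ _ _ _ _ ?_, ?_, hσ'⟩
  · rw [hv]
    exact .cons _ _ _ _ _ _ _ _ _ exec (.nil _ _ _)
  · simp only [listTime, if_true, hv, List.length_singleton]
    omega

theorem forIn_singleton {i x d : ℕ} (hd : σ.store.inEdges (σ.nreg x) = [d])
    (hP : HaltsWithin P (σ.setEdge i d) T Q) : HaltsWithin (.forIn i x P) σ (2 + T) Q := by
  obtain ⟨t, σ', exec, ht, hσ'⟩ := hP
  refine ⟨1 + (σ.store.inEdges (σ.nreg x)).length + (t + 0), σ', .forIn _ _ _ _ _ _ ?_, ?_, hσ'⟩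
  · rw [hd]
    exact .cons _ _ _ _ _ _ _ _ _ exec (.nil _ _ _)
  · rw [hd, List.length_singleton]
    omega

theorem forOut_pair {i x d d' : ℕ} (hd : σ.store.outEdges (σ.nreg x) = [d, d'])
    (hP : HaltsWithin P (σ.setEdge i d) T₁ fun σ' => HaltsWithin P (σ'.setEdge i d') T₂ Q) :
    HaltsWithin (.forOut i x P) σ (3 + T₁ + T₂) Q := by
  obtain ⟨t, σ', exec, ht, t', σ'', exec', ht', hσ''⟩ := hP
  refine ⟨1 + (σ.store.outEdges (σ.nreg x)).length + (t + (t' + 0)), σ'',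
    .forOut _ _ _ _ _ _ ?_, ?_, hσ''⟩
  · rw [hd]
    exact .cons _ _ _ _ _ _ _ _ _ exec (.cons _ _ _ _ _ _ _ _ _ exec' (.nil _ _ _))
  · rw [hd, List.length_cons, List.length_singleton]
    omega

end HaltsWithin

/-- A search over a list. If `J p` says that either the search has succeeded or `p` holds, then
`p` collects what the failures so far have revealed. -/
theorem exists_execEdges {α : Type*} {g : α → ℕ} {i : ℕ} {J : Prop → State LV LE → Prop} {p : Prop}
    {C : α → Prop} (l : List α) (hJ : J p σ)
    (step : ∀ q, ∀ a ∈ l, ∀ σ', J q σ' → HaltsWithin P (σ'.setEdge i (g a)) T (J (q ∧ C a))) :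
    ∃ (t : ℕ) (σ' : State LV LE), ExecEdges i P (l.map g) σ t σ' ∧ t ≤ l.length * T ∧
      J (p ∧ ∀ a ∈ l, C a) σ' := by
  induction l generalizing p σ with
  | nil => exact ⟨0, σ, .nil _ _ _, Nat.zero_le _, by simpa using hJ⟩
  | cons a l ih =>
    obtain ⟨t, σ', exec, ht, hσ'⟩ := step p a List.mem_cons_self σ hJ
    obtain ⟨t', σ'', exec', ht', hσ''⟩ :=
      ih hσ' fun q b hb => step q b (List.mem_cons_of_mem a hb)
    refine ⟨_, _, .cons _ _ _ _ _ _ _ _ _ exec exec', ?_, ?_⟩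
    · rw [List.length_cons, Nat.succ_mul]
      omega
    · rwa [List.forall_mem_cons, ← and_assoc]

theorem Store.IsCopy.haltsWithin_forOut (hS : S.IsCopy G f h) {i x b : ℕ} {v : G.V}
    {J : Prop → State LV LE → Prop} {p : Prop} {C : G.E → Prop} (store_eq : σ.store = S)
    (nreg_eq : σ.nreg x = f v) (hb : G.outdeg v ≤ b) (hJ : J p σ)
    (step : ∀ q e σ', G.s e = v → J q σ' → HaltsWithin P (σ'.setEdge i (h e)) T (J (q ∧ C e))) :
    HaltsWithin (.forOut i x P) σ (1 + b + b * T) (J (p ∧ ∀ e, G.s e = v → C e)) := by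
  obtain ⟨l, -, mem_iff, hl⟩ := hS.exists_outEdges_eq_map v
  obtain ⟨t, σ', exec, ht, hσ'⟩ :=
    exists_execEdges l hJ fun q e he σ' => step q e σ' ((mem_iff e).1 he)
  have list_eq : σ.store.outEdges (σ.nreg x) = l.map h := by rw [store_eq, nreg_eq, hl]
  have length_le : l.length ≤ b := by
    rwa [← List.length_map h, ← hl, hS.length_outEdges]
  refine ⟨_, _, .forOut _ _ _ _ _ _ (list_eq ▸ exec), ?_, by simpa only [mem_iff] using hσ'⟩
  rw [list_eq, List.length_map]
  have := Nat.mul_le_mul_right T length_le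
  omega

/-! ## Iteration of a step -/

variable {rules : Set (RRule LV LE)} {B : Cmd LV LE} {k n N : ℕ}

theorem haltsWithin_while (hB : ∀ H, Derives rules G H → PerformsStepWithin rules B k H)
    (hN : ∀ n H, DerivesIn rules n G H → n ≤ N) (m : ℕ) (hm : N < n + m)
    (hd : DerivesIn rules n G H) (hflag : σ.flag 0 = true) (hσ : σ.store.Represents H) :
    HaltsWithin (.while (.flag 0) B) σ (m * (k + 1) + 1) fun σ' =>
      ∃ H', σ'.store.Represents H' ∧ IsNormalFormOf rules H' G := by
  induction m generalizing n H σ with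
  | zero => exact absurd (hN n H hd) (by omega)
  | succ m ih =>
    rw [Nat.succ_mul]
    obtain ⟨t, σ', exec, ht, ⟨hflag', H', hd', hσ'⟩ | ⟨hflag', normal, hσ'⟩⟩ := hB H ⟨n, hd⟩ σ hσ
    · obtain ⟨t', σ'', exec', ht', hσ''⟩ := ih (by omega) (.succ hd hd') hflag' hσ'
      exact ⟨_, σ'', .whileTrue _ _ _ _ _ _ _ hflag exec exec', by omega, hσ''⟩
    · have halt : Exec (.while (.flag 0) B) σ' 1 σ' :=
        .whileFalse _ _ _ (ne_true_of_eq_false hflag')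
      exact ⟨_, σ', .whileTrue _ _ _ _ _ _ _ hflag exec halt, by omega, H, hσ', ⟨n, hd⟩, normal⟩

theorem haltsWithin_loop (hB : ∀ H, Derives rules G H → PerformsStepWithin rules B k H)
    (hN : ∀ n H, DerivesIn rules n G H → n ≤ N) (hσ : σ.store.Represents G) :
    HaltsWithin (loop B) σ ((N + 1) * (k + 1) + 2) fun σ' =>
      ∃ H, σ'.store.Represents H ∧ IsNormalFormOf rules H G := by
  refine (HaltsWithin.seq (.setFlag ?_)).of_le (T₁ := 1 + ((N + 1) * (k + 1) + 1)) (by omega)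
  exact haltsWithin_while hB hN (N + 1) (n := 0) (by omega) (.zero (Iso.refl G).isomorphic)
    (Function.update_self 0 true σ.flag) hσ

end GraphMachine

/-! ## A program for one step -/

namespace FBT

open NLabel RGraph GraphMachine

variable {G : RGraph NLabel ELabel} {v : G.V} {X : Move G} {S : Store NLabel ELabel} {f : G.V → ℕ}
  {h : G.E → ℕ} {σ σ' : State NLabel ELabel} {p q : Prop} {b : ℕ} {e e₁ e₂ : G.E}

/-- What a program for one step has to achieve on a copy of `G`: either the store holds a graph
directly derived from `G` and the flag `0` is up, or `G` is in normal form, is still in the store,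
and the flag is down. -/
def StepOutcome (G : RGraph NLabel ELabel) (σ : State NLabel ELabel) : Prop :=
  (σ.flag 0 = true ∧ ∃ H, G.DirectlyDerives rules H ∧ σ.store.Represents H) ∨
    (σ.flag 0 = false ∧ G.InNormalForm rules ∧ σ.store.Represents G)

/-- The state holds the store `S`, the node `x` in register `0`, and has not performed a step. -/
structure IsReady (S : Store NLabel ELabel) (x : ℕ) (σ : State NLabel ELabel) : Prop where
  store_eq : σ.store = S
  nreg_zero : σ.nreg 0 = x
  flag_zero : σ.flag 0 = false

theorem IsReady.stepOutcome (hσ : IsReady S (f v) σ) (hS : S.IsCopy G f h) (hv : RootedAt G v)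
    (normal : ∀ X, ¬ Redex G v X) : StepOutcome G σ :=
  .inr ⟨hσ.flag_zero, hv.inNormalForm_iff.2 normal, hσ.store_eq ▸ hS.represents⟩

namespace RootedAt

theorem root_eq_true_iff (hv : RootedAt G v) (hS : S.IsCopy G f h) {w : G.V} :
    S.root (f w) = true ↔ w = v := by
  rw [← hv.p_eq_true_iff, hS.root, Option.some.injEq]

theorem filter_root_eq (hv : RootedAt G v) (hS : S.IsCopy G f h) :
    S.nodes.filter (S.root · = true) = {f v} := by
  ext x
  rw [Finset.mem_filter, Finset.mem_singleton]
  constructor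
  · rintro ⟨hx, root⟩
    obtain ⟨w, rfl⟩ := hS.exists_node hx
    rw [(hv.root_eq_true_iff hS).1 root]
  · rintro rfl
    exact ⟨hS.mem_nodes v, (hv.root_eq_true_iff hS).2 rfl⟩

theorem numRooted_le_one (hv : RootedAt G v) (hS : S.IsCopy G f h) {S' : Store NLabel ELabel}
    (nodes : S'.nodes ⊆ S.nodes) (root : ∀ x, S'.root x = true → S.root x = true) :
    S'.numRooted ≤ 1 := by
  rw [← Finset.card_singleton (f v), ← hv.filter_root_eq hS]
  exact Finset.card_le_card fun x hx =>
    Finset.mem_filter.2 ((Finset.mem_filter.1 hx).imp (@nodes x) (root x))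

theorem nodesWith_box_true (hv : RootedAt G v) (hS : S.IsCopy G f h) :
    S.nodesWith box true = [f v] := by
  rw [Store.nodesWith, ← Finset.sort_singleton (· ≤ ·) (f v), ← hv.filter_root_eq hS]
  congr 1
  refine Finset.filter_congr fun x hx => and_iff_right_of_imp fun root => ?_
  obtain ⟨w, rfl⟩ := hS.exists_node hx
  rw [hS.lab_eq_iff, (hv.root_eq_true_iff hS).1 root, hv.l_root]

open Classical in
theorem update_root (hv : RootedAt G v) (hS : S.IsCopy G f h) (r w : G.V) :
    Function.update (Function.update S.root (f v) false) (f r) true (f w) = decide (w = r) := by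
  by_cases hr : w = r
  · rw [hr, Function.update_self, decide_eq_true rfl]
  rw [Function.update_of_ne (hS.injV.ne hr), decide_eq_false hr, Function.update_apply]
  split_ifs with hw
  · rfl
  · exact Bool.eq_false_iff.2 fun root => hw (congrArg f ((hv.root_eq_true_iff hS).1 root))

end RootedAt

theorem Redex.site_notMem (hX : Redex G v X) : X.site ∉ X.delV := by
  cases hX with
  | top cherry no_in => exact (top cherry no_in).root_notMem
  | prune cherry t_eq in_unique => exact (prune cherry t_eq in_unique).root_notMem
  | descend => exact Set.notMem_empty _
  | ascend => exact Set.notMem_empty _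

theorem Redex.notMem (hX : Redex G v X) : v ∉ X.delV := by
  cases hX with
  | top cherry no_in => exact (top cherry no_in).root_notMem
  | prune cherry => exact not_or.2 ⟨cherry.ne_root₁.symm, cherry.ne_root₂.symm⟩
  | descend => exact Set.notMem_empty _
  | ascend => exact Set.notMem_empty _

/-- The common end of all steps: give the label `a` to the node in register `x`, move the root from
the node in register `0` to the one in register `1`, and raise the flag `0`. -/
def commitCmd (x : ℕ) (a : NLabel) : Cmd NLabel ELabel :=
  .seq (.relabel x a) (.seq (.setRoot 0 false) (.seq (.setRoot 1 true) (.setFlag 0 true)))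

theorem haltsWithin_commitCmd (hS : S.IsCopy G f h) (hv : RootedAt G v) (hX : Redex G v X)
    {N D : Finset ℕ} {x : ℕ} (store_eq : σ.store = { S with nodes := N, edges := D })
    (hN : ↑N = f '' X.delVᶜ) (hD : ↑D = h '' X.delEᶜ) (old_root : σ.nreg 0 = f v)
    (new_root : σ.nreg 1 = f X.root) (site : σ.nreg x = f X.site) :
    HaltsWithin (commitCmd x X.label) σ 7 (StepOutcome G) := by
  obtain ⟨H, ⟨R⟩⟩ := hX.removesLeaves.noDangling.exists_reduct
  obtain ⟨store, nreg, ereg, flag⟩ := σ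
  subst store_eq
  have mem {w : G.V} (hw : w ∉ X.delV) : f w ∈ N := by
    rw [← Finset.mem_coe, hN]
    exact Set.mem_image_of_mem f hw
  have subset : N ⊆ S.nodes := by
    rw [← Finset.coe_subset, hN, ← hS.rangeV]
    exact Set.image_subset_range _ _
  have root_of_update {y : ℕ} (hy : Function.update S.root (f v) false y = true) :
      S.root y = true := by
    rw [Function.update_apply] at hy
    split_ifs at hy
    exact hy
  refine .seq (T₁ := 1 + 1) (T₂ := 5) (.relabel site (mem hX.site_notMem)
    (hv.numRooted_le_one hS subset fun _ => id) ?_)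
  refine .seq (T₁ := 1 + 1) (T₂ := 3) (.setRoot old_root (mem hX.notMem)
    (hv.numRooted_le_one hS subset fun _ => id) ?_)
  refine .seq (T₁ := 1 + 1) (T₂ := 1) (.setRoot new_root (mem hX.root_notMem)
    (hv.numRooted_le_one hS subset fun _ => root_of_update) (.setFlag ?_))
  refine .inl ⟨rfl, H, hv.directlyDerives_iff.2 ⟨X, hX, ⟨R⟩⟩,
    hS.represents_reduct R hN hD rfl rfl rfl (fun w => ?_) fun w => congrArg some ?_⟩
  · by_cases hw : w = X.site
    · rw [hw, X.edit_l_site]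
      exact congrArg some (Function.update_self (f X.site) X.label S.lab).symm
    · rw [X.edit_l_of_ne hw, hS.lab]
      exact congrArg some (Function.update_of_ne (hS.injV.ne hw) X.label S.lab).symm
  · exact (hv.update_root hS X.root w).symm

theorem haltsWithin_commitCmd_of_delV_eq_empty (hS : S.IsCopy G f h) (hv : RootedAt G v)
    {r s : G.V} {a : NLabel} (hX : Redex G v ⟨∅, ∅, r, s, a⟩) {x : ℕ} (store_eq : σ.store = S)
    (old_root : σ.nreg 0 = f v) (new_root : σ.nreg 1 = f r) (site : σ.nreg x = f s) :
    HaltsWithin (commitCmd x a) σ 7 (StepOutcome G) :=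
  haltsWithin_commitCmd hS hv hX store_eq
    (by rw [Set.compl_empty, Set.image_univ, hS.rangeV])
    (by rw [Set.compl_empty, Set.image_univ, hS.rangeE]) old_root new_root site

/-- Put the source of the only edge into the node in register `0` into register `1`. -/
def parentCmd : Cmd NLabel ELabel := .seq (.forIn 0 0 .skip) (.source 1 0)

theorem haltsWithin_parentCmd {Q : State NLabel ELabel → Prop} (hS : S.IsCopy G f h)
    (hσ : IsReady S (f (G.t e)) σ) (in_unique : ∀ d, G.t d = G.t e → d = e)
    (hQ : Q ((σ.setEdge 0 (h e)).setNode 1 (f (G.s e)))) : HaltsWithin parentCmd σ 4 Q := by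
  have list_eq : σ.store.inEdges (σ.nreg 0) = [h e] := by
    rw [hσ.store_eq, hσ.nreg_zero, hS.inEdges_eq_singleton in_unique]
  refine .seq (T₁ := 3) (T₂ := 1) (.forIn_singleton (T := 1) list_eq (.skip (.source ?_ hQ)))
  simp [State.setEdge, hσ.store_eq, hS.src]

/-! ### Climbing from a leaf -/

/-- Apply `r4` at a root without outgoing edges, if possible. -/
def ascendCmd : Cmd NLabel ELabel :=
  guards [(.indegEq 0 1, true)]
    (.seq parentCmd (guards [(.hasLabel 1 box, true)] (commitCmd 1 box)))

theorem haltsWithin_ascendCmd (hS : S.IsCopy G f h) (hv : RootedAt G v) (hσ : IsReady S (f v) σ)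
    (no_out : ∀ e, G.s e ≠ v) : HaltsWithin ascendCmd σ 15 (StepOutcome G) := by
  have redex_iff {X : Move G} : Redex G v X ↔ ∃ e, X = ⟨∅, ∅, G.s e, G.s e, box⟩ ∧ G.t e = v ∧
      G.l (G.s e) = some box ∧ ∀ d, G.t d = v → d = e := by
    constructor
    · rintro (⟨cherry, -⟩ | ⟨cherry, -, -⟩ | ⟨path⟩ | ⟨t_eq, l_parent, -, in_unique⟩)
      exacts [absurd cherry.s₁ (no_out _), absurd cherry.s₁ (no_out _),
        absurd path.s_eq (no_out _), ⟨_, rfl, t_eq, l_parent, in_unique⟩]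
    · rintro ⟨e, rfl, t_eq, l_parent, in_unique⟩
      exact .ascend t_eq l_parent no_out in_unique
  refine HaltsWithin.guards (T := 13) (C := G.indeg v = 1) ?_ (fun h1 => ?_) fun h1 => ?_
  · simp [Test.Holds, hσ.store_eq, hσ.nreg_zero, hS.length_inEdges]
  · obtain ⟨e, rfl, in_unique⟩ := indeg_eq_one_iff.1 h1
    refine .seq (T₁ := 4) (T₂ := 9) (haltsWithin_parentCmd hS hσ in_unique ?_)
    refine HaltsWithin.guards (T := 7) (C := G.l (G.s e) = some box) ?_ (fun hl => ?_) fun hl => ?_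
    · simp [Test.Holds, State.setEdge, State.setNode, hσ.store_eq, hS.lab_eq_iff]
    · exact haltsWithin_commitCmd_of_delV_eq_empty hS hv (redex_iff.2 ⟨e, rfl, rfl, hl, in_unique⟩)
        hσ.store_eq hσ.nreg_zero rfl rfl
    · refine IsReady.stepOutcome ⟨hσ.store_eq, hσ.nreg_zero, hσ.flag_zero⟩ hS hv fun X hX => ?_
      obtain ⟨d, -, t_eq, l_parent, -⟩ := redex_iff.1 hX
      exact hl (in_unique d t_eq ▸ l_parent)
  · refine hσ.stepOutcome hS hv fun X hX => h1 ?_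
    obtain ⟨e, -, t_eq, -, in_unique⟩ := redex_iff.1 hX
    exact indeg_eq_one_iff.2 ⟨e, t_eq, in_unique⟩

/-! ### Searching for a path -/

/-- Test whether the edges in the edge registers `0` and `1` form a `SquarePath`, given that the
first of them passes its own tests; if so, keep its target in register `3` and raise the
flag `1`. -/
def testPathCmd : Cmd NLabel ELabel :=
  .seq (.target 2 1) (guards
    [(.sameNode 2 0, false), (.sameNode 2 1, false), (.hasLabel 2 box, true)]
    (.seq (.copyNode 3 1) (.setFlag 1 true)))

/-- Search for a `SquarePath` that starts at the node in register `0`. -/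
def searchCmd : Cmd NLabel ELabel :=
  .forOut 0 0 (.seq (.target 1 0) (guards
    [(.sameNode 1 0, false), (.hasLabel 1 box, true)] (.forOut 1 1 testPathCmd)))

/-- The invariant of the search for a `SquarePath` from `v`: the flag `1` records a success, and
without a success so far, `p` holds. -/
structure IsSearching (G : RGraph NLabel ELabel) (v : G.V) (S : Store NLabel ELabel) (f : G.V → ℕ)
    (p : Prop) (σ : State NLabel ELabel) : Prop extends IsReady S (f v) σ where
  found : σ.flag 1 = true → ∃ e e', SquarePath G v e e' ∧ σ.nreg 3 = f (G.t e)
  not_found : σ.flag 1 = false → p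

theorem IsSearching.imp (hσ : IsSearching G v S f p σ) (hpq : p → q)
    (store_eq : σ'.store = σ.store) (flag_eq : σ'.flag = σ.flag)
    (nreg_zero : σ'.nreg 0 = σ.nreg 0) (nreg_three : σ'.nreg 3 = σ.nreg 3) :
    IsSearching G v S f q σ' where
  store_eq := store_eq.trans hσ.store_eq
  nreg_zero := nreg_zero.trans hσ.nreg_zero
  flag_zero := flag_eq ▸ hσ.flag_zero
  found hf := nreg_three ▸ hσ.found (flag_eq ▸ hf)
  not_found hf := hpq (hσ.not_found (flag_eq ▸ hf))

theorem haltsWithin_testPathCmd (hS : S.IsCopy G f h) {e' : G.E} (s_eq : G.s e = v)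
    (s_eq' : G.s e' = G.t e) (t_ne : G.t e ≠ v) (l_child : G.l (G.t e) = some box)
    (hσ : IsSearching G v S f p σ) (nreg_one : σ.nreg 1 = f (G.t e)) :
    HaltsWithin testPathCmd (σ.setEdge 1 (h e')) 7 fun σ' =>
      IsSearching G v S f (p ∧ ¬ SquarePath G v e e') σ' ∧ σ'.nreg 1 = f (G.t e) := by
  have target_eq : (σ.setEdge 1 (h e')).store.tgt ((σ.setEdge 1 (h e')).ereg 1) = f (G.t e') := by
    simp [State.setEdge, hσ.store_eq, hS.tgt]
  refine .seq (T₁ := 1) (T₂ := 6) (.target target_eq ?_)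
  have path_iff : SquarePath G v e e' ↔
      G.t e' ≠ v ∧ G.t e' ≠ G.t e ∧ G.l (G.t e') = some box :=
    ⟨fun path => ⟨path.t_ne', path.t_ne_t, path.l_grandchild⟩,
      fun ⟨t_ne', t_ne_t, l_grandchild⟩ =>
        ⟨s_eq, s_eq', t_ne, t_ne', t_ne_t, l_child, l_grandchild⟩⟩
  refine HaltsWithin.guards (T := 2) (C := SquarePath G v e e') ?_ (fun path => ?_)
    fun no_path => ?_
  · simp [Test.Holds, State.setEdge, State.setNode, hσ.store_eq, hσ.nreg_zero, nreg_one,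
      hS.injV.eq_iff, hS.lab_eq_iff, path_iff]
  · refine .seq (T₁ := 1) (T₂ := 1) (.copyNode (.setFlag ⟨⟨⟨hσ.store_eq, hσ.nreg_zero,
      hσ.flag_zero⟩, fun _ => ⟨e, e', path, nreg_one⟩, by simp⟩, nreg_one⟩))
  · exact ⟨hσ.imp (⟨·, no_path⟩) rfl rfl rfl rfl, nreg_one⟩

theorem haltsWithin_searchCmd (hS : S.IsCopy G f h) (hb : ∀ w, G.outdeg w ≤ b)
    (hσ : IsSearching G v S f p σ) :
    HaltsWithin searchCmd σ (1 + b + b * (5 + b + b * 7))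
      (IsSearching G v S f (p ∧ ∀ e, G.s e = v → ∀ e', ¬ SquarePath G v e e')) := by
  refine hS.haltsWithin_forOut hσ.store_eq hσ.nreg_zero (hb v) hσ fun q e σ s_eq hσ => ?_
  have target_eq : (σ.setEdge 0 (h e)).store.tgt ((σ.setEdge 0 (h e)).ereg 0) = f (G.t e) := by
    simp [State.setEdge, hσ.store_eq, hS.tgt]
  refine (HaltsWithin.seq (T₁ := 1) (T₂ := 4 + b + b * 7) (.target target_eq ?_)).of_le (by omega)
  have hσ' : IsSearching G v S f q ((σ.setEdge 0 (h e)).setNode 1 (f (G.t e))) :=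
    hσ.imp id rfl rfl rfl rfl
  refine (HaltsWithin.guards (T := 1 + b + b * 7) (C := G.t e ≠ v ∧ G.l (G.t e) = some box)
    ?_ (fun ⟨t_ne, l_child⟩ => ?_) fun no_child => ?_).of_le
      (by simp only [List.length_cons, List.length_nil]; omega)
  · simp [Test.Holds, State.setEdge, State.setNode, hσ.store_eq, hσ.nreg_zero, hS.injV.eq_iff,
      hS.lab_eq_iff]
  · refine (hS.haltsWithin_forOut (J := fun p σ => IsSearching G v S f p σ ∧ σ.nreg 1 = f (G.t e))
      hσ'.store_eq rfl (hb _) ⟨hσ', rfl⟩ fun p e' σ s_eq' hσ =>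
        haltsWithin_testPathCmd hS s_eq s_eq' t_ne l_child hσ.1 hσ.2).mono le_rfl fun σ hσ =>
      hσ.1.imp (And.imp_right fun no_path e' path => no_path e' path.s_eq' path) rfl rfl rfl rfl
  · exact hσ'.imp (⟨·, fun e' path => no_child ⟨path.t_ne, path.l_child⟩⟩) rfl rfl rfl rfl

/-- Apply `r3`, given that register `1` holds the middle node of a path found by the search. -/
def descendCmd : Cmd NLabel ELabel := .seq (.copyNode 1 3) (commitCmd 0 tri)

theorem haltsWithin_descendCmd (hS : S.IsCopy G f h) (hv : RootedAt G v) (hσ : IsReady S (f v) σ)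
    {e' : G.E} (path : SquarePath G v e e') (nreg_three : σ.nreg 3 = f (G.t e)) :
    HaltsWithin descendCmd σ 8 (StepOutcome G) :=
  .seq (T₁ := 1) (T₂ := 7) (.copyNode (haltsWithin_commitCmd_of_delV_eq_empty hS hv (.descend path)
    hσ.store_eq hσ.nreg_zero nreg_three hσ.nreg_zero))

/-! ### Pruning a cherry -/

/-- The two edges out of `v`, and their targets, are in the registers `1`, `2` and `3`, `4`. -/
structure IsAtFork (S : Store NLabel ELabel) (f : G.V → ℕ) (h : G.E → ℕ) (v : G.V) (e₁ e₂ : G.E)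
    (σ : State NLabel ELabel) : Prop extends IsReady S (f v) σ where
  s_eq_iff : ∀ e, G.s e = v ↔ e = e₁ ∨ e = e₂
  edge_ne : e₁ ≠ e₂
  ereg_one : σ.ereg 1 = h e₁
  ereg_two : σ.ereg 2 = h e₂
  nreg_three : σ.nreg 3 = f (G.t e₁)
  nreg_four : σ.nreg 4 = f (G.t e₂)

/-- Load the registers of `IsAtFork` from a node with two outgoing edges. -/
def loadForkCmd : Cmd NLabel ELabel :=
  .seq (.forOut 0 0 (.seq (.copyEdge 1 2) (.copyEdge 2 0))) (.seq (.target 3 1) (.target 4 2))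

theorem haltsWithin_loadForkCmd (hS : S.IsCopy G f h) (hσ : IsReady S (f v) σ)
    (h2 : G.outdeg v = 2) :
    HaltsWithin loadForkCmd σ 9 fun σ' => ∃ e₁ e₂, IsAtFork S f h v e₁ e₂ σ' := by
  obtain ⟨e₁, e₂, list_eq, edge_ne, s_eq_iff⟩ := hS.exists_outEdges_eq_pair h2
  rw [← hσ.store_eq, ← hσ.nreg_zero] at list_eq
  refine .seq (T₁ := 7) (T₂ := 2) (.forOut_pair (T₁ := 2) (T₂ := 2) list_eq ?_)
  refine .seq (T₁ := 1) (T₂ := 1) (.copyEdge (.copyEdge ?_))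
  refine .seq (T₁ := 1) (T₂ := 1) (.copyEdge (.copyEdge ?_))
  refine .seq (T₁ := 1) (T₂ := 1) (.target ?_ (.target ?_ ⟨e₁, e₂, ⟨hσ.store_eq, hσ.nreg_zero,
    hσ.flag_zero⟩, s_eq_iff, edge_ne, rfl, rfl, rfl, rfl⟩))
  · simp [State.setEdge, hσ.store_eq, hS.tgt]
  · simp [State.setNode, State.setEdge, hσ.store_eq, hS.tgt]

namespace Cherry

theorem swap (cherry : Cherry G v e₁ e₂) : Cherry G v e₂ e₁ where
  s₁ := cherry.s₂
  s₂ := cherry.s₁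
  t_ne := cherry.t_ne.symm
  l₁ := cherry.l₂
  l₂ := cherry.l₁
  out e he := (cherry.out e he).symm
  leaf₁ := cherry.leaf₂
  leaf₂ := cherry.leaf₁
  in₁ := cherry.in₂
  in₂ := cherry.in₁

theorem edge_ne (cherry : Cherry G v e₁ e₂) : e₁ ≠ e₂ := fun he => cherry.t_ne (congrArg G.t he)

theorem outdeg_eq_two (cherry : Cherry G v e₁ e₂) : G.outdeg v = 2 :=
  RGraph.outdeg_eq_two cherry.edge_ne fun e =>
    ⟨cherry.out e, Or.rec (· ▸ cherry.s₁) (· ▸ cherry.s₂)⟩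

theorem of_ne (cherry : Cherry G v e₁ e₂) {d₁ d₂ : G.E} (s₁ : G.s d₁ = v) (s₂ : G.s d₂ = v)
    (hne : d₁ ≠ d₂) : Cherry G v d₁ d₂ := by
  rcases cherry.out d₁ s₁ with rfl | rfl <;> rcases cherry.out d₂ s₂ with rfl | rfl
  exacts [absurd rfl hne, cherry, cherry.swap, absurd rfl hne]

end Cherry

theorem cherry_iff (hne : e₁ ≠ e₂) (s_eq_iff : ∀ e, G.s e = v ↔ e = e₁ ∨ e = e₂) :
    Cherry G v e₁ e₂ ↔ G.l (G.t e₁) = some box ∧ G.l (G.t e₂) = some box ∧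
      G.outdeg (G.t e₁) = 0 ∧ G.outdeg (G.t e₂) = 0 ∧
      G.indeg (G.t e₁) = 1 ∧ G.indeg (G.t e₂) = 1 := by
  simp only [outdeg_eq_zero_iff, indeg_eq_one_iff]
  constructor
  · intro cherry
    exact ⟨cherry.l₁, cherry.l₂, cherry.leaf₁, cherry.leaf₂, ⟨e₁, rfl, cherry.in₁⟩,
      ⟨e₂, rfl, cherry.in₂⟩⟩
  · rintro ⟨l₁, l₂, leaf₁, leaf₂, ⟨d₁, -, in₁⟩, d₂, -, in₂⟩
    have in₁' (e : G.E) (he : G.t e = G.t e₁) : e = e₁ := (in₁ e he).trans (in₁ e₁ rfl).symm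
    exact ⟨(s_eq_iff _).2 (.inl rfl), (s_eq_iff _).2 (.inr rfl),
      fun ht => hne (in₁' e₂ ht.symm).symm, l₁, l₂, fun e => (s_eq_iff e).1, leaf₁, leaf₂, in₁',
      fun e he => (in₂ e he).trans (in₂ e₂ rfl).symm⟩

theorem Redex.exists_cherry (hX : Redex G v X) (no_path : ∀ e e', ¬ SquarePath G v e e')
    (exists_out : ∃ e, G.s e = v) :
    (∃ e₁ e₂, Cherry G v e₁ e₂) ∧ (G.indeg v = 0 ∨ G.indeg v = 1) := by
  cases hX with
  | top cherry no_in => exact ⟨⟨_, _, cherry⟩, .inl (indeg_eq_zero_iff.2 no_in)⟩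
  | prune cherry t_eq in_unique =>
    exact ⟨⟨_, _, cherry⟩, .inr (indeg_eq_one_iff.2 ⟨_, t_eq, in_unique⟩)⟩
  | descend path => exact absurd path (no_path _ _)
  | ascend _ _ no_out => exact absurd exists_out (not_exists.2 no_out)

theorem coe_erase_erase_eq_image_compl {α β : Type*} [DecidableEq β] {g : α → β} {A : Finset β}
    (hg : Function.Injective g) (range_eq : Set.range g = ↑A) {a b : α} :
    ↑((A.erase (g a)).erase (g b)) = g '' {a, b}ᶜ := by
  rw [Finset.coe_erase, Finset.coe_erase, ← range_eq, Set.image_compl_eq_range_sdiff_image hg,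
    Set.image_pair, Set.sdiff_sdiff, Set.singleton_union]

/-- Delete the fork in the registers, and move the root to the node in register `1`. -/
def pruneCmd : Cmd NLabel ELabel :=
  .seq (.delEdge 1) (.seq (.delEdge 2) (.seq (.delNode 3) (.seq (.delNode 4) (commitCmd 1 box))))

theorem haltsWithin_pruneCmd (hS : S.IsCopy G f h) (hv : RootedAt G v) {w : G.V}
    (cherry : Cherry G v e₁ e₂) (hX : Redex G v ⟨{G.t e₁, G.t e₂}, {e₁, e₂}, w, w, box⟩)
    (hσ : IsAtFork S f h v e₁ e₂ σ) (nreg_one : σ.nreg 1 = f w) :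
    HaltsWithin pruneCmd σ 11 (StepOutcome G) := by
  obtain ⟨⟨rfl, nreg_zero, -⟩, -, -, ereg_one, ereg_two, nreg_three, nreg_four⟩ := hσ
  have exists_of_mem {d : ℕ} (hd : d ∈ (σ.store.edges.erase (h e₁)).erase (h e₂)) :
      ∃ e, h e = d ∧ e ≠ e₁ ∧ e ≠ e₂ := by
    rw [Finset.mem_erase, Finset.mem_erase] at hd
    obtain ⟨ne₂, ne₁, hd⟩ := hd
    obtain ⟨e, rfl⟩ := hS.exists_edge hd
    exact ⟨e, rfl, ne_of_apply_ne h ne₁, ne_of_apply_ne h ne₂⟩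
  have isolated₁ (d : ℕ) (hd : d ∈ (σ.store.edges.erase (h e₁)).erase (h e₂)) :
      σ.store.src d ≠ f (G.t e₁) ∧ σ.store.tgt d ≠ f (G.t e₁) := by
    obtain ⟨e, rfl, ne₁, -⟩ := exists_of_mem hd
    rw [hS.src, hS.tgt]
    exact ⟨hS.injV.ne (cherry.leaf₁ e), hS.injV.ne (mt (cherry.in₁ e) ne₁)⟩
  have isolated₂ (d : ℕ) (hd : d ∈ (σ.store.edges.erase (h e₁)).erase (h e₂)) :
      σ.store.src d ≠ f (G.t e₂) ∧ σ.store.tgt d ≠ f (G.t e₂) := by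
    obtain ⟨e, rfl, -, ne₂⟩ := exists_of_mem hd
    rw [hS.src, hS.tgt]
    exact ⟨hS.injV.ne (cherry.leaf₂ e), hS.injV.ne (mt (cherry.in₂ e) ne₂)⟩
  refine .seq (T₁ := 1) (T₂ := 10) (.delEdge ereg_one (hS.mem_edges e₁) ?_)
  refine .seq (T₁ := 1) (T₂ := 9) (.delEdge ereg_two
    (Finset.mem_erase.2 ⟨hS.injE.ne cherry.edge_ne.symm, hS.mem_edges e₂⟩) ?_)
  refine .seq (T₁ := 1) (T₂ := 8) (.delNode nreg_three (hS.mem_nodes _) isolated₁ ?_)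
  refine .seq (T₁ := 1) (T₂ := 7) (.delNode nreg_four
    (Finset.mem_erase.2 ⟨hS.injV.ne cherry.t_ne.symm, hS.mem_nodes _⟩) isolated₂ ?_)
  refine haltsWithin_commitCmd hS hv hX rfl ?_ ?_ nreg_zero nreg_one nreg_one
  · exact coe_erase_erase_eq_image_compl hS.injV hS.rangeV
  · exact coe_erase_erase_eq_image_compl hS.injE hS.rangeE

/-- At a cherry, perform the step; at any other fork, do nothing. -/
def pruneForkCmd : Cmd NLabel ELabel :=
  guards [(.hasLabel 3 box, true), (.hasLabel 4 box, true), (.outdegEq 3 0, true),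
      (.outdegEq 4 0, true), (.indegEq 3 1, true), (.indegEq 4 1, true)]
    (.ite (.indegEq 0 0) (.seq (.copyNode 1 0) pruneCmd)
      (guards [(.indegEq 0 1, true)] (.seq parentCmd pruneCmd)))

theorem haltsWithin_pruneForkCmd (hS : S.IsCopy G f h) (hv : RootedAt G v)
    (no_path : ∀ e e', ¬ SquarePath G v e e') (hσ : IsAtFork S f h v e₁ e₂ σ) :
    HaltsWithin pruneForkCmd σ 25 (StepOutcome G) := by
  have s₁ : G.s e₁ = v := (hσ.s_eq_iff e₁).2 (.inl rfl)
  have s₂ : G.s e₂ = v := (hσ.s_eq_iff e₂).2 (.inr rfl)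
  refine HaltsWithin.guards (T := 18) (C := Cherry G v e₁ e₂) ?_ (fun cherry => ?_)
    fun no_cherry => ?_
  · simp [Test.Holds, hσ.store_eq, hσ.nreg_three, hσ.nreg_four, hS.lab_eq_iff, hS.length_outEdges,
      hS.length_inEdges, cherry_iff hσ.edge_ne hσ.s_eq_iff]
  · have indeg_eq : (σ.store.inEdges (σ.nreg 0)).length = G.indeg v := by
      rw [hσ.store_eq, hσ.nreg_zero, hS.length_inEdges]
    refine .ite (T := 17) (fun h0 => ?_) fun h0 => ?_
    · have no_in := indeg_eq_zero_iff.1 (indeg_eq.symm.trans h0)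
      refine (HaltsWithin.seq (T₁ := 1) (T₂ := 11) (.copyNode ?_)).of_le (by omega)
      exact haltsWithin_pruneCmd hS hv cherry (.top cherry no_in) ⟨⟨hσ.store_eq, hσ.nreg_zero,
        hσ.flag_zero⟩, hσ.s_eq_iff, hσ.edge_ne, hσ.ereg_one, hσ.ereg_two, hσ.nreg_three,
        hσ.nreg_four⟩ hσ.nreg_zero
    · refine HaltsWithin.guards (T := 15) (C := G.indeg v = 1) ?_ (fun h1 => ?_) fun h1 => ?_
      · simp [Test.Holds, indeg_eq]
      · obtain ⟨e, rfl, in_unique⟩ := indeg_eq_one_iff.1 h1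
        refine .seq (T₁ := 4) (T₂ := 11) (haltsWithin_parentCmd hS hσ.toIsReady in_unique ?_)
        exact haltsWithin_pruneCmd hS hv cherry (.prune cherry rfl in_unique) ⟨⟨hσ.store_eq,
          hσ.nreg_zero, hσ.flag_zero⟩, hσ.s_eq_iff, hσ.edge_ne, hσ.ereg_one, hσ.ereg_two,
          hσ.nreg_three, hσ.nreg_four⟩ rfl
      · refine hσ.stepOutcome hS hv fun X hX => ?_
        rcases (hX.exists_cherry no_path ⟨e₁, s₁⟩).2 with indeg | indeg
        exacts [h0 (indeg_eq.trans indeg), h1 indeg]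
  · refine hσ.stepOutcome hS hv fun X hX => no_cherry ?_
    obtain ⟨d₁, d₂, cherry⟩ := (hX.exists_cherry no_path ⟨e₁, s₁⟩).1
    exact cherry.of_ne s₁ s₂ hσ.edge_ne

/-- Apply one of `r0`, `r1`, `r2`, if the root has two outgoing edges that form a cherry. -/
def cherryCmd : Cmd NLabel ELabel :=
  guards [(.outdegEq 0 2, true)] (.seq loadForkCmd pruneForkCmd)

theorem haltsWithin_cherryCmd (hS : S.IsCopy G f h) (hv : RootedAt G v) (hσ : IsReady S (f v) σ)
    (no_path : ∀ e e', ¬ SquarePath G v e e') (exists_out : ∃ e, G.s e = v) :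
    HaltsWithin cherryCmd σ 36 (StepOutcome G) := by
  refine HaltsWithin.guards (T := 34) (C := G.outdeg v = 2) ?_ (fun h2 => ?_) fun h2 => ?_
  · simp [Test.Holds, hσ.store_eq, hσ.nreg_zero, hS.length_outEdges]
  · refine .seq (T₁ := 9) (T₂ := 25) ((haltsWithin_loadForkCmd hS hσ h2).mono le_rfl ?_)
    rintro σ' ⟨e₁, e₂, fork⟩
    exact haltsWithin_pruneForkCmd hS hv no_path fork
  · refine hσ.stepOutcome hS hv fun X hX => h2 ?_
    obtain ⟨e₁, e₂, cherry⟩ := (hX.exists_cherry no_path exists_out).1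
    exact cherry.outdeg_eq_two

/-! ### The whole step -/

/-- Find the root and perform a step there, if there is one. The rules that apply depend on whether
the root starts a `SquarePath`, and otherwise on whether it has children. -/
def stepCmd : Cmd NLabel ELabel :=
  .seq (.setFlag 0 false) (.forNodes 0 box true (.seq (.setFlag 1 false) (.seq searchCmd
    (.ite (.flag 1) descendCmd (.ite (.outdegEq 0 0) ascendCmd cherryCmd)))))

/-- A bound on the running time of `stepCmd` on graphs with at most `b` edges out of each node. The
summand that depends on `b` is due to `searchCmd`. -/
def stepTime (b : ℕ) : ℕ := 43 + b + b * (5 + b + b * 7)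

theorem performsStepWithin_stepCmd (hv : RootedAt G v) (hb : ∀ w, G.outdeg w ≤ b) :
    PerformsStepWithin rules stepCmd (stepTime b) G := by
  intro σ hσ
  obtain ⟨f, h, hS⟩ := hσ.exists_isCopy
  let σ₁ : State NLabel ELabel := { σ with flag := Function.update σ.flag 0 false }
  let σ₂ : State NLabel ELabel :=
    { σ₁.setNode 0 (f v) with flag := Function.update σ₁.flag 1 false }
  have start : IsSearching G v σ.store f True σ₂ :=
    ⟨⟨rfl, rfl, rfl⟩, fun hf => by simp [σ₂] at hf, fun _ => trivial⟩
  have outdeg_eq {p : Prop} {σ' : State NLabel ELabel} (hσ' : IsSearching G v σ.store f p σ') :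
      (σ'.store.outEdges (σ'.nreg 0)).length = G.outdeg v := by
    rw [hσ'.store_eq, hσ'.nreg_zero, hS.length_outEdges]
  have dispatch {σ' : State NLabel ELabel}
      (hσ' : IsSearching G v σ.store f (True ∧ ∀ e, G.s e = v → ∀ e', ¬ SquarePath G v e e') σ') :
      HaltsWithin (.ite (.flag 1) descendCmd (.ite (.outdegEq 0 0) ascendCmd cherryCmd)) σ' 38
        (StepOutcome G) := by
    refine .ite (T := 37) (fun found => ?_) fun not_found => .ite (T := 36) (fun h0 => ?_)
      fun h0 => ?_
    · obtain ⟨e, e', path, nreg_three⟩ := hσ'.found found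
      exact (haltsWithin_descendCmd hS hv hσ'.toIsReady path nreg_three).of_le (by omega)
    · have no_out := outdeg_eq_zero_iff.1 ((outdeg_eq hσ').symm.trans h0)
      exact (haltsWithin_ascendCmd hS hv hσ'.toIsReady no_out).of_le (by omega)
    · have no_path := (hσ'.not_found (Bool.eq_false_iff.2 not_found)).2
      have exists_out : ∃ e, G.s e = v := by
        by_contra no_out
        exact h0 ((outdeg_eq hσ').trans (outdeg_eq_zero_iff.2 (not_exists.1 no_out)))
      exact haltsWithin_cherryCmd hS hv hσ'.toIsReady
        (fun e e' path => no_path e path.s_eq e' path) exists_out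
  have search := HaltsWithin.seq (T₂ := 38)
    ((haltsWithin_searchCmd hS hb start).mono le_rfl fun _ => dispatch)
  exact (HaltsWithin.seq (T₁ := 1) (.setFlag (.forNodes_singleton (hv.nodesWith_box_true hS)
    (.seq (T₁ := 1) (.setFlag search))))).of_le (by rw [stepTime]; omega)

theorem performsStepWithin_of_derives {H : RGraph NLabel ELabel} (hG : IsInput G)
    (hb : G.DegreeBounded b) (hH : Derives rules G H) :
    PerformsStepWithin rules stepCmd (stepTime b) H := by
  obtain ⟨n, hd⟩ := hH
  obtain ⟨v, hv, -⟩ := exists_isMarkedAt_of_derivesIn hG hd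
  exact performsStepWithin_stepCmd hv.rootedAt fun w =>
    (Nat.le_add_left _ _).trans (degreeBounded_of_derivesIn hG hb hd w)

theorem haltsWithin_loop_stepCmd (hG : IsInput G) (hb : G.DegreeBounded b)
    (hσ : σ.store.Represents G) :
    HaltsWithin (loop stepCmd) σ ((3 * (stepTime b + 1) + 2) * G.order) fun σ' =>
      ∃ H, σ'.store.Represents H ∧ IsNormalFormOf rules H G := by
  refine (haltsWithin_loop (N := 2 * G.order) (fun H => performsStepWithin_of_derives hG hb)
    (fun n H => length_le hG) hσ).of_le ?_
  have := order_pos hG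
  calc (2 * G.order + 1) * (stepTime b + 1) + 2
    _ ≤ 3 * G.order * (stepTime b + 1) + 2 * G.order := by gcongr <;> omega
    _ = (3 * (stepTime b + 1) + 2) * G.order := by ring

end FBT

theorem mainTheorem9 :
    -- termination, and a linear bound on the length of every derivation
    (∃ c : ℕ, ∀ G : RGraph NLabel ELabel, FBT.IsInput G →
      ∀ (n : ℕ) (H : RGraph NLabel ELabel), RGraph.DerivesIn FBT.rules n G H → n ≤ c * G.order) ∧
    -- normal forms exist, and each of them decides whether the input is a full binary tree
    (∀ G : RGraph NLabel ELabel, FBT.IsInput G →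
      (¬ ∃ f : ℕ → RGraph NLabel ELabel,
        f 0 = G ∧ ∀ i, RGraph.DirectlyDerives FBT.rules (f i) (f (i + 1))) ∧
      (∃ H, RGraph.IsNormalFormOf FBT.rules H G) ∧
      ∀ H, RGraph.IsNormalFormOf FBT.rules H G →
        (H.Isomorphic FBT.single ↔ (FBT.unlabelled G).IsFullBinaryTree)) ∧
    -- on inputs of bounded degree, rewriting to a normal form takes linear time
    (∃ B : GraphMachine.Cmd NLabel ELabel, ∀ b : ℕ, ∃ k C : ℕ,
      ∀ G : RGraph NLabel ELabel, FBT.IsInput G → G.DegreeBounded b →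
        (∀ H, RGraph.Derives FBT.rules G H →
          GraphMachine.PerformsStepWithin FBT.rules B k H) ∧
        (∀ σ : GraphMachine.State NLabel ELabel, σ.store.Represents G →
          ∃ (t : ℕ) (σ' : GraphMachine.State NLabel ELabel) (H : RGraph NLabel ELabel),
            GraphMachine.Exec (GraphMachine.loop B) σ t σ' ∧ t ≤ C * G.order ∧
            σ'.store.Represents H ∧ RGraph.IsNormalFormOf FBT.rules H G)) := by
  refine ⟨⟨2, fun G hG n H hd => FBT.length_le hG hd⟩, fun G hG => ⟨FBT.not_exists_infinite hG,
    FBT.exists_isNormalFormOf hG, fun H hH => FBT.isomorphic_single_iff hG hH⟩, FBT.stepCmd,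
    fun b => ⟨FBT.stepTime b, 3 * (FBT.stepTime b + 1) + 2, fun G hG hb =>
      ⟨fun H hH => FBT.performsStepWithin_of_derives hG hb hH, fun σ hσ => ?_⟩⟩⟩
  obtain ⟨t, σ', exec, ht, H, hσ', hH⟩ := FBT.haltsWithin_loop_stepCmd hG hb hσ
  exact ⟨t, σ', H, exec, ht, hσ', hH⟩
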